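/- Fix a shape $\alpha>0$ and, for $m>0$, let $\nu^{m}$ be the Gamma distribution with shape $\alpha$ and mean $m$ (density $\frac{e^{-\alpha z/m}(\alpha z/m)^{\alpha}}{z\,\Gamma(\alpha)}$ at $z>0$). Let $d(m,m')=\mathrm{KL}(\nu^{m},\nu^{m'})$. Consider a bandit model with $K$ arms with laws $\nu^{\mu_1},\dots,\nu^{\mu_K}$, $\mu_a>0$. At each round $t\ge 1$ an arm $A_t$ is selected and a sample $Z_t$ is observed. Let $\mathcal F_t=\sigma(A_1,Z_1,\dots,A_t,Z_t)$. The arm $A_t$ is measurable with respect to $\sigma(\mathcal F_{t-1},U_t)$, where $U_t$ is uniform on $[0,1]$ and independent of $\mathcal F_{t-1}$, and the conditional law of $Z_t$ given $\mathcal F_{t-1}$ and $A_t$ is $\nu^{\mu_{A_t}}$. Let $N_a(t)$ be the number of selections of arm $a$ in the first $t$ rounds and $\hat\mu_a(t)$ the average of the observations from arm $a$ in these rounds. For $t\in\mathbb N$ put $$X_a(t)=N_a(t)\,d(\hat\mu_a(t),\mu_a)-2\ln(4+\ln N_a(t)),$$ with the convention that the correction $2\ln(4+\ln N_a(t))$ is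 $+\infty$, the term $N_a(t)\,d(\hat\mu_a(t),\mu_a)$ is $0$, and hence $X_a(t)=-\infty$, as long as $N_a(t)=0$. Define, for $\lambda\in(1/2,1)$, $$g_\Gamma(\lambda)=2\lambda-2\lambda\ln(4\lambda)+\ln\zeta(2\lambda)-\ln(1-\lambda).$$ Then $\boldsymbol X=(X_a)_{a=1}^K$ is $g_\Gamma$-DCC: for every $\lambda\in(1/2,1)$ there are non-negative $(\mathcal F_t)$-martingales $M_1^\lambda,\dots,M_K^\lambda$ with $M_a^\lambda(0)=1$ such that, for every arm $a$, almost surely $M_a^\lambda(t)\ge e^{\lambda X_a(t)-g_\Gamma(\lambda)}$ for all $t\in\mathbb N$, and such that for every $\mathcal S\subseteq\{1,\dots,K\}$ the product $\prod_{a\in\mathcal S}M_a^\lambda(t)$ is an $(\mathcal F_t)$-martingale. Moreover, for every $x>0$ the minimum $$C^{g_\Gamma}(x)=\min_{\lambda\in(1/2,1)}\frac{g_\Gamma(\lambda)+x}{\lambda}$$ is attained, and for every non-empty subset $\mathcal S\subseteq\{1,\dots,K\}$ and every $x>0$, $$\mathbb P\left(\exists t\in\mathbb N:\ \sum_{a\in\mathcal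 S}N_a(t)\,d(\hat\mu_a(t),\mu_a)\ \ge\ \sum_{a\in\mathcal S}2\ln(4+\ln N_a(t))+|\mathcal S|\,C^{g_\Gamma}\!\left(\frac{x}{|\mathcal S|}\right)\right)\le e^{-x}.$$ -/

import Mathlib

open MeasureTheory ProbabilityTheory
open scoped ENNReal

noncomputable section

namespace GammaBandit

/-- The Gamma distribution with shape `α` and mean `m`, i.e. with rate `α / m`: its density at
`z > 0` is `exp (-α z / m) * (α z / m) ^ α / (z * Γ(α))`. -/
def gammaLaw (α m : ℝ) : Measure ℝ := gammaMeasure α (α / m)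

/-- `d(m, m')`: the Kullback-Leibler divergence between the Gamma distributions with shape `α`
and means `m` and `m'`. -/
def kl (α m m' : ℝ) : ℝ := (InformationTheory.klDiv (gammaLaw α m) (gammaLaw α m')).toReal

variable {Ω : Type*} {K : ℕ}

/-- `N_a(t)`: the number of selections of arm `a` in the rounds `1, …, t`. -/
def pulls (A : ℕ → Ω → Fin K) (a : Fin K) (t : ℕ) (ω : Ω) : ℕ :=
  ∑ s ∈ Finset.Icc 1 t, if A s ω = a then 1 else 0

/-- `S_a(t)`: the sum of the observations obtained from arm `a` in the rounds `1, …, t`. -/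
def obsSum (A : ℕ → Ω → Fin K) (Z : ℕ → Ω → ℝ) (a : Fin K) (t : ℕ) (ω : Ω) : ℝ :=
  ∑ s ∈ Finset.Icc 1 t, if A s ω = a then Z s ω else 0

/-- The empirical mean `S_a(t) / N_a(t)`, meaningful once `N_a(t) ≠ 0`. -/
def empMean (A : ℕ → Ω → Fin K) (Z : ℕ → Ω → ℝ) (a : Fin K) (t : ℕ) (ω : Ω) : ℝ :=
  obsSum A Z a t ω / pulls A a t ω

/-- The information `N_a(t) * d(empirical mean of arm a at time t, m)`; it is `0` if
`N_a(t) = 0`. -/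
def info (α m : ℝ) (A : ℕ → Ω → Fin K) (Z : ℕ → Ω → ℝ) (a : Fin K) (t : ℕ) (ω : Ω) : ℝ :=
  pulls A a t ω * kl α (empMean A Z a t ω) m

/-- The correction `2 ln (4 + ln N_a(t))`, with the convention that it is `+∞` as long as
`N_a(t) = 0`. -/
def correction (A : ℕ → Ω → Fin K) (a : Fin K) (t : ℕ) (ω : Ω) : EReal :=
  if pulls A a t ω = 0 then ⊤
  else ((2 * Real.log (4 + Real.log (pulls A a t ω)) : ℝ) : EReal)

/-- The corrected process `X_a(t) = N_a(t) d(empirical mean, m_a) - 2 ln (4 + ln N_a(t))`,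
which is `-∞` as long as `N_a(t) = 0`. -/
def correctedProcess (α : ℝ) (m : Fin K → ℝ) (A : ℕ → Ω → Fin K) (Z : ℕ → Ω → ℝ)
    (a : Fin K) (t : ℕ) (ω : Ω) : EReal :=
  (info α (m a) A Z a t ω : EReal) - correction A a t ω

/-- The σ-algebra generated by `A_1, Z_1, …, A_t, Z_t`. -/
abbrev history (A : ℕ → Ω → Fin K) (Z : ℕ → Ω → ℝ) (t : ℕ) : MeasurableSpace Ω :=
  ⨆ s ∈ Set.Icc 1 t,
    (MeasurableSpace.comap (A s) inferInstance ⊔ MeasurableSpace.comap (Z s) inferInstance)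

/-- The filtration generated by the observations. -/
def historyFiltration [mΩ : MeasurableSpace Ω] (A : ℕ → Ω → Fin K) (Z : ℕ → Ω → ℝ)
    (hA : ∀ t, Measurable (A t)) (hZ : ∀ t, Measurable (Z t)) : Filtration ℕ mΩ where
  seq := history A Z
  mono' := fun _ _ hij =>
    biSup_mono fun _ hs => ⟨hs.1, hs.2.trans hij⟩
  le' := fun _ => iSup₂_le fun s _ => sup_le (hA s).comap_le (hZ s).comap_le

/-- A bandit model with `K` Gamma arms of common shape `α` and means `m`: at round `t + 1` the arm
`A_{t+1}` is chosen from the past and from an independent uniform variable (which may be ignored),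
and given the past and `A_{t+1}`, the observation `Z_{t+1}` has the law of that arm. -/
structure IsGammaBandit [MeasurableSpace Ω] (P : Measure Ω) (α : ℝ) (m : Fin K → ℝ)
    (A : ℕ → Ω → Fin K) (Z : ℕ → Ω → ℝ) : Prop where
  measurable_arm : ∀ t, Measurable (A t)
  measurable_obs : ∀ t, Measurable (Z t)
  sampling_rule : ∀ t, ∃ U : Ω → ℝ, Measurable U ∧
    P.map U = volume.restrict (Set.Icc (0 : ℝ) 1) ∧
    Indep (MeasurableSpace.comap U inferInstance) (history A Z t) P ∧
    Measurable[history A Z t ⊔ MeasurableSpace.comap U inferInstance] (A (t + 1))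
  cond_law : ∀ t, ∀ B : Set ℝ, MeasurableSet B →
    P[(Z (t + 1) ⁻¹' B).indicator (fun _ => (1 : ℝ)) |
        history A Z t ⊔ MeasurableSpace.comap (A (t + 1)) inferInstance]
      =ᵐ[P] fun ω => (gammaLaw α (m (A (t + 1) ω))).real B

/-- A test martingale: a non-negative martingale of unit initial value. -/
structure IsTestMartingale [mΩ : MeasurableSpace Ω] (P : Measure Ω) (ℱ : Filtration ℕ mΩ)
    (M : ℕ → Ω → ℝ) : Prop where
  martingale : Martingale M ℱ P
  nonneg : ∀ t ω, 0 ≤ M t ω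
  init : ∀ ω, M 0 ω = 1

/-- The process `X` (with values in the extended reals, where `exp (-∞) = 0`) is `g`-DCC, for a
function `g` on the interval `Λ`, with respect to the filtration `ℱ`: for every `l ∈ Λ` there are
test martingales `M a` that dominate `exp (l * X_a(t) - g l)` at all times, almost surely, and
whose products over subsets of arms are martingales. -/
def IsDCC [mΩ : MeasurableSpace Ω] (P : Measure Ω) (ℱ : Filtration ℕ mΩ) (Λ : Set ℝ) (g : ℝ → ℝ)
    (X : Fin K → ℕ → Ω → EReal) : Prop :=
  ∀ l ∈ Λ, ∃ M : Fin K → ℕ → Ω → ℝ,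
    (∀ a, IsTestMartingale P ℱ (M a) ∧
      ∀ᵐ ω ∂P, ∀ t, EReal.exp ((l : EReal) * X a t ω - (g l : EReal))
        ≤ ENNReal.ofReal (M a t ω)) ∧
    ∀ S : Finset (Fin K), Martingale (fun t ω => ∏ a ∈ S, M a t ω) ℱ P

/-- The set of values `(g(l) + x) / l` for `l ∈ Λ`. -/
def thresholdValues (Λ : Set ℝ) (g : ℝ → ℝ) (x : ℝ) : Set ℝ :=
  (fun l => (g l + x) / l) '' Λ

/-- The threshold `C^g(x)`, the minimum of `(g(l) + x) / l` over `l ∈ Λ`. -/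
def threshold (Λ : Set ℝ) (g : ℝ → ℝ) (x : ℝ) : ℝ := sInf (thresholdValues Λ g x)

/-- The function `2 l - 2 l ln (4 l) + ln ζ(2 l) - ln (1 - l)`, for `l` in `(1/2, 1)`. -/
def gGamma (l : ℝ) : ℝ :=
  2 * l - 2 * l * Real.log (4 * l) + Real.log (riemannZeta ((2 * l : ℝ) : ℂ)).re
    - Real.log (1 - l)

end GammaBandit

end

open MeasureTheory ProbabilityTheory
open scoped ENNReal

namespace GammaBandit

/-! For one arm of rate `r`, the likelihood ratio of `n` observations with sum `s` against relative
rate `θ` is `θ ^ (α n) * exp (-(θ - 1) r s)`. Under the true law this is a test martingale, and so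
is its average over any prior on `θ > 0`. Each round moves only the factor of the selected arm, so
products over arms are martingales too (`IsGammaBandit.setLIntegral_prod_armLik_succ`). What remains
is a prior whose mixture dominates `exp (l X - g l)`.

The information after `n` observations is `r s - a - a ln (r s / a)` with `a = α n`. A beta prime
prior on `θ / (1 - l) - 1` with total shape `a` makes the mixture an explicit Gamma integral that
reproduces the `l`-th power of the maximal likelihood ratio. The prior tuned to a smaller shape `b`
still does so up to the factor `(1 - l) b / a` (`le_lintegral_betaPrime`). Mixing over sample sizes
`k` with weights `height l k / k` therefore leaves at time `n` the factor `(1 - l)` times the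
average of `height l k` over `k ≤ n`, which is at least `(1 - l) * height l n` by monotonicity
(`le_mixLik_prior`). Averaging in this way replaces a union bound over sample sizes. The weights
have total mass at most one because `(4 + ln k) ^ (-2l) / k` is summable for `2l > 1` and `ζ(2l) ≥ 1
/ (2l - 1)` (`sum_height_div_le_one`).

For the deviation bound, take the minimising `l`: on the event the product of the martingales
reaches `exp x`, and Ville's inequality applies. The minimum exists because `gGamma` is continuous
and blows up at both ends of the interval. -/

/-! ### Gamma laws: tilting, mean and divergence. -/

lemma gammaMeasure_Iic_zero (a r : ℝ) : gammaMeasure a r (Set.Iic 0) = 0 := by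
  rw [gammaMeasure, withDensity_apply _ measurableSet_Iic, ← setLIntegral_congr Iio_ae_eq_Iic]
  exact lintegral_gammaPDF_of_nonpos le_rfl

lemma measurable_gammaPDF (a r : ℝ) : Measurable (gammaPDF a r) :=
  (measurable_gammaPDFReal a r).ennreal_ofReal

lemma gammaPDF_mul_tilt {a r θ : ℝ} (hr : 0 < r) (hθ : 0 < θ) (z : ℝ) :
    gammaPDF a r z * ENNReal.ofReal (θ ^ a * Real.exp (-((θ - 1) * (r * z))))
      = gammaPDF a (θ * r) z := by
  rcases lt_or_ge z 0 with hz | hz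
  · simp [gammaPDF_of_neg hz]
  · rw [gammaPDF_of_nonneg hz, gammaPDF_of_nonneg hz, mul_comm, ← ENNReal.ofReal_mul (by positivity),
      Real.mul_rpow hθ.le hr.le,
      show -(θ * r * z) = -((θ - 1) * (r * z)) + -(r * z) by ring, Real.exp_add]
    congr 1
    ring

/-- Tilting the rate of a Gamma law by the factor `θ`. -/
lemma gammaMeasure_withDensity_tilt {a r θ : ℝ} (hr : 0 < r) (hθ : 0 < θ) :
    (gammaMeasure a r).withDensity
        (fun z => ENNReal.ofReal (θ ^ a * Real.exp (-((θ - 1) * (r * z)))))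
      = gammaMeasure a (θ * r) := by
  rw [gammaMeasure, gammaMeasure, ← withDensity_mul _ (measurable_gammaPDF _ _) (by fun_prop)]
  congr 1
  funext z
  exact gammaPDF_mul_tilt hr hθ z

lemma lintegral_tilt_gammaMeasure {a r θ : ℝ} (ha : 0 < a) (hr : 0 < r) (hθ : 0 < θ) :
    ∫⁻ z, ENNReal.ofReal (θ ^ a * Real.exp (-((θ - 1) * (r * z)))) ∂gammaMeasure a r = 1 := by
  rw [← setLIntegral_univ, ← withDensity_apply _ MeasurableSet.univ,
    gammaMeasure_withDensity_tilt hr hθ]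
  exact (isProbabilityMeasure_gammaMeasure ha (mul_pos hθ hr)).measure_univ

/-- Size-biasing a Gamma law raises its shape by one, so computing the mean reduces to the
normalisation of a density. -/
lemma mul_gammaPDFReal {a r : ℝ} (ha : 0 < a) (hr : 0 < r) (z : ℝ) :
    gammaPDFReal a r z * z = a / r * gammaPDFReal (a + 1) r z := by
  unfold gammaPDFReal
  split_ifs with hz
  · have hΓ := (Real.Gamma_pos_of_pos ha).ne'
    rw [Real.Gamma_add_one ha.ne', Real.rpow_add_one hr.ne', add_sub_cancel_right]
    rcases hz.eq_or_lt with rfl | hz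
    · simp [Real.zero_rpow ha.ne']
    · rw [Real.rpow_sub_one hz.ne']
      field_simp
  · simp

lemma integrable_gammaPDFReal {a r : ℝ} (ha : 0 < a) (hr : 0 < r) :
    Integrable (gammaPDFReal a r) := by
  refine (lintegral_ofReal_ne_top_iff_integrable (by fun_prop)
    (ae_of_all _ (gammaPDFReal_nonneg ha hr))).1 ?_
  exact (lintegral_gammaPDF_eq_one ha hr).trans_ne ENNReal.one_ne_top

lemma integral_gammaPDFReal {a r : ℝ} (ha : 0 < a) (hr : 0 < r) :
    ∫ z, gammaPDFReal a r z = 1 := by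
  rw [integral_eq_lintegral_of_nonneg_ae (ae_of_all _ (gammaPDFReal_nonneg ha hr)) (by fun_prop)]
  simp_rw [← gammaPDF.eq_1]
  rw [lintegral_gammaPDF_eq_one ha hr, ENNReal.toReal_one]

lemma integrable_id_gammaMeasure {a r : ℝ} (ha : 0 < a) (hr : 0 < r) :
    Integrable (fun z => z) (gammaMeasure a r) := by
  rw [gammaMeasure, integrable_withDensity_iff_integrable_smul' (measurable_gammaPDF _ _)
    (ae_of_all _ fun _ => ENNReal.ofReal_lt_top)]
  simp_rw [gammaPDF, ENNReal.toReal_ofReal (gammaPDFReal_nonneg ha hr _), smul_eq_mul,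
    mul_gammaPDFReal ha hr]
  exact (integrable_gammaPDFReal (by linarith) hr).const_mul _

lemma integral_id_gammaMeasure {a r : ℝ} (ha : 0 < a) (hr : 0 < r) :
    ∫ z, z ∂gammaMeasure a r = a / r := by
  rw [gammaMeasure, integral_withDensity_eq_integral_toReal_smul (measurable_gammaPDF _ _)
    (ae_of_all _ fun _ => ENNReal.ofReal_lt_top)]
  simp_rw [gammaPDF, ENNReal.toReal_ofReal (gammaPDFReal_nonneg ha hr _), smul_eq_mul,
    mul_gammaPDFReal ha hr]
  rw [integral_const_mul, integral_gammaPDFReal (by linarith) hr, mul_one]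

/-- The first law is the tilt of the second by `θ = m' / m`, so the log-likelihood ratio is affine
in the observation and its expectation needs only the mean. -/
lemma kl_eq {α m m' : ℝ} (hα : 0 < α) (hm : 0 < m) (hm' : 0 < m') :
    kl α m m' = α * (m / m' - 1 - Real.log (m / m')) := by
  set r := α / m' with hr
  set θ := m' / m with hθ
  have hr0 : 0 < r := by positivity
  have hθ0 : 0 < θ := by positivity
  have hrm : α / m = θ * r := by rw [hr, hθ]; field_simp
  have hrm0 : 0 < α / m := by positivity
  have : IsProbabilityMeasure (gammaMeasure α r) := isProbabilityMeasure_gammaMeasure hα hr0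
  have : IsProbabilityMeasure (gammaMeasure α (α / m)) := isProbabilityMeasure_gammaMeasure hα hrm0
  have hd := gammaMeasure_withDensity_tilt (a := α) hr0 hθ0
  rw [← hrm] at hd
  have hac : gammaMeasure α (α / m) ≪ gammaMeasure α r := by
    rw [← hd]; exact withDensity_absolutelyContinuous _ _
  have hllr : llr (gammaMeasure α (α / m)) (gammaMeasure α r)
      =ᵐ[gammaMeasure α (α / m)] fun z => α * Real.log θ - (θ - 1) * r * z := by
    have h1 := Measure.rnDeriv_withDensity (gammaMeasure α r)
      (f := fun z => ENNReal.ofReal (θ ^ α * Real.exp (-((θ - 1) * (r * z))))) (by fun_prop)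
    rw [hd] at h1
    filter_upwards [hac.ae_le h1] with z hz
    rw [llr, hz, ENNReal.toReal_ofReal (by positivity), Real.log_mul (by positivity)
      (Real.exp_pos _).ne', Real.log_exp, Real.log_rpow hθ0]
    ring
  rw [kl, gammaLaw, gammaLaw, InformationTheory.toReal_klDiv_of_measure_eq hac (by simp),
    integral_congr_ae hllr, integral_sub (integrable_const _)
      ((integrable_id_gammaMeasure hα hrm0).const_mul _), integral_const_mul ((θ - 1) * r),
    integral_id_gammaMeasure hα hrm0, integral_const, probReal_univ, one_smul,
    show m / m' = θ⁻¹ by rw [hθ, inv_div], Real.log_inv, hrm]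
  field_simp
  ring

/-! ### Mixture likelihood ratios and their martingale property. -/

section
/-- The likelihood ratio, mixed over the prior `ρ` on the relative rate `θ`, of `n` Gamma
observations with sum `s`. -/
noncomputable def mixLik (α r : ℝ) (ρ : Measure ℝ) (n : ℕ) (s : ℝ) : ℝ≥0∞ :=
  ∫⁻ θ, ENNReal.ofReal (θ ^ (α * n) * Real.exp (-((θ - 1) * (r * s)))) ∂ρ

lemma mixLik_zero_zero (α r : ℝ) (ρ : Measure ℝ) [IsProbabilityMeasure ρ] :
    mixLik α r ρ 0 0 = 1 := by
  simp [mixLik]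

lemma measurable_mixLik (α r : ℝ) (ρ : Measure ℝ) [SFinite ρ] :
    Measurable fun p : ℕ × ℝ => mixLik α r ρ p.1 p.2 := by
  unfold mixLik
  refine Measurable.lintegral_prod_right'
    (f := fun q : (ℕ × ℝ) × ℝ =>
      ENNReal.ofReal (q.2 ^ (α * q.1.1) * Real.exp (-((q.2 - 1) * (r * q.1.2))))) ?_
  fun_prop

lemma _root_.Measurable.mixLik {Ω : Type*} {G : MeasurableSpace Ω} {α r : ℝ} {ρ : Measure ℝ}
    [SFinite ρ] {f : Ω → ℕ} {g : Ω → ℝ} (hf : Measurable f) (hg : Measurable g) :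
    Measurable fun ω => mixLik α r ρ (f ω) (g ω) := by
  have h := (measurable_mixLik α r ρ).comp (hf.prodMk hg)
  exact h

/-- One-step martingale identity: after exchanging the integrals, a new observation contributes for
each `θ` a factor that is a probability density. This needs `θ > 0`, hence a prior that does not
charge the half-line `θ ≤ 0`. -/
lemma lintegral_mixLik_succ {α r : ℝ} (hα : 0 < α) (hr : 0 < r) (ρ : Measure ℝ) [SFinite ρ]
    (hρ : ρ (Set.Iic 0) = 0) (n : ℕ) (s : ℝ) :
    ∫⁻ z, mixLik α r ρ (n + 1) (s + z) ∂gammaMeasure α r = mixLik α r ρ n s := by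
  have := isProbabilityMeasure_gammaMeasure hα hr
  unfold mixLik
  rw [lintegral_lintegral_swap (by fun_prop)]
  have hpos : ∀ᵐ θ ∂ρ, 0 < θ := by
    rw [ae_iff]; convert hρ using 2; ext; simp
  refine lintegral_congr_ae ?_
  filter_upwards [hpos] with θ hθ
  have hsplit : ∀ z, ENNReal.ofReal
      (θ ^ (α * ((n + 1 : ℕ) : ℝ)) * Real.exp (-((θ - 1) * (r * (s + z)))))
      = ENNReal.ofReal (θ ^ (α * n) * Real.exp (-((θ - 1) * (r * s))))
        * ENNReal.ofReal (θ ^ α * Real.exp (-((θ - 1) * (r * z)))) := by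
    intro z
    rw [← ENNReal.ofReal_mul (by positivity)]
    congr 1
    rw [show α * ((n + 1 : ℕ) : ℝ) = α * n + α by push_cast; ring, Real.rpow_add hθ,
      show -((θ - 1) * (r * (s + z))) = -((θ - 1) * (r * s)) + -((θ - 1) * (r * z)) by ring,
      Real.exp_add]
    ring
  simp_rw [hsplit]
  rw [lintegral_const_mul _ (by fun_prop), lintegral_tilt_gammaMeasure hα hr hθ, mul_one]

/-- If the conditional law of `Z` given `G` is constant on an event `E` of `G`, then on `E` it is
independent of every `G`-measurable variable. -/
lemma map_restrict_prod_of_condExp {Ω β : Type*} {G mΩ : MeasurableSpace Ω} [MeasurableSpace β]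
    {P : Measure Ω} [IsProbabilityMeasure P] (hG : G ≤ mΩ) {E : Set Ω}
    (hE : MeasurableSet[G] E) {Y : Ω → β} (hY : Measurable[G] Y) {Z : Ω → ℝ} (hZ : Measurable Z)
    {ν : Measure ℝ} [IsProbabilityMeasure ν]
    (hc : ∀ B : Set ℝ, MeasurableSet B →
      ∀ᵐ ω ∂P, ω ∈ E → (P[(Z ⁻¹' B).indicator (fun _ => (1 : ℝ)) | G]) ω = ν.real B) :
    (P.restrict E).map (fun ω => (Y ω, Z ω)) = ((P.restrict E).map Y).prod ν := by
  have hY' : Measurable Y := hY.mono hG le_rfl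
  symm
  refine Measure.prod_eq fun C B hC hB => ?_
  rw [Measure.map_apply (hY'.prodMk hZ) (hC.prod hB), Measure.map_apply hY' hC,
    Measure.restrict_apply (hY' hC), Measure.restrict_apply ((hY'.prodMk hZ) (hC.prod hB))]
  have hD : MeasurableSet[G] (Y ⁻¹' C ∩ E) := (hY hC).inter hE
  have hD' := hG _ hD
  have key := setIntegral_condExp (μ := P) hG (f := (Z ⁻¹' B).indicator (fun _ => (1 : ℝ)))
    ((integrable_const 1).indicator (hZ hB)) hD
  rw [setIntegral_congr_ae (g := fun _ => ν.real B) hD'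
    ((hc B hB).mono fun ω h hω => h hω.2), setIntegral_const, smul_eq_mul,
    integral_indicator (hZ hB), setIntegral_const, smul_eq_mul, mul_one, measureReal_restrict_apply
    (hZ hB)] at key
  rw [show (fun ω => (Y ω, Z ω)) ⁻¹' C ×ˢ B ∩ E = Z ⁻¹' B ∩ (Y ⁻¹' C ∩ E) by
    ext ω; simp; tauto]
  rw [← ENNReal.toReal_eq_toReal_iff' (by finiteness) (by finiteness), ENNReal.toReal_mul]
  exact key.symm

variable {Ω : Type*} {K : ℕ} {A : ℕ → Ω → Fin K} {Z : ℕ → Ω → ℝ}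

lemma pulls_succ (a : Fin K) (t : ℕ) (ω : Ω) :
    pulls A a (t + 1) ω = pulls A a t ω + if A (t + 1) ω = a then 1 else 0 :=
  Finset.sum_Icc_succ_top (by omega) _

lemma obsSum_succ (a : Fin K) (t : ℕ) (ω : Ω) :
    obsSum A Z a (t + 1) ω = obsSum A Z a t ω + if A (t + 1) ω = a then Z (t + 1) ω else 0 :=
  Finset.sum_Icc_succ_top (by omega) _

lemma measurable_history_arm {s t : ℕ} (hs : s ∈ Finset.Icc 1 t) :
    Measurable[history A Z t] (A s) := by
  rw [measurable_iff_comap_le]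
  exact le_sup_left.trans (le_iSup₂_of_le (f := fun s (_ : s ∈ Set.Icc 1 t) =>
    MeasurableSpace.comap (A s) inferInstance ⊔ MeasurableSpace.comap (Z s) inferInstance)
    s (by simpa using hs) le_rfl)

lemma measurable_history_obs {s t : ℕ} (hs : s ∈ Finset.Icc 1 t) :
    Measurable[history A Z t] (Z s) := by
  rw [measurable_iff_comap_le]
  exact le_sup_right.trans (le_iSup₂_of_le (f := fun s (_ : s ∈ Set.Icc 1 t) =>
    MeasurableSpace.comap (A s) inferInstance ⊔ MeasurableSpace.comap (Z s) inferInstance)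
    s (by simpa using hs) le_rfl)

lemma measurable_pulls (a : Fin K) (t : ℕ) : Measurable[history A Z t] (pulls A a t) := by
  let _ := history A Z t
  unfold pulls
  refine Finset.measurable_fun_sum _ fun s hs => ?_
  exact Measurable.ite (measurable_history_arm hs (measurableSet_singleton a))
    measurable_const measurable_const

lemma measurable_obsSum (a : Fin K) (t : ℕ) : Measurable[history A Z t] (obsSum A Z a t) := by
  let _ := history A Z t
  unfold obsSum
  refine Finset.measurable_fun_sum _ fun s hs => ?_
  exact Measurable.ite (measurable_history_arm hs (measurableSet_singleton a))
    (measurable_history_obs hs) measurable_const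

/-- The mixture likelihood ratio of arm `a` after `t` rounds. -/
noncomputable def armLik (α : ℝ) (m : Fin K → ℝ) (ρ : Fin K → Measure ℝ) (A : ℕ → Ω → Fin K)
    (Z : ℕ → Ω → ℝ) (a : Fin K) (t : ℕ) (ω : Ω) : ℝ≥0∞ :=
  mixLik α (α / m a) (ρ a) (pulls A a t ω) (obsSum A Z a t ω)

section

variable {α : ℝ} {m : Fin K → ℝ} {ρ : Fin K → Measure ℝ}

lemma measurable_armLik [∀ a, SFinite (ρ a)] (a : Fin K) (t : ℕ) :
    Measurable[history A Z t] (armLik α m ρ A Z a t) :=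
  (measurable_pulls a t).mixLik (measurable_obsSum a t)

lemma armLik_zero [∀ a, IsProbabilityMeasure (ρ a)] (a : Fin K) (ω : Ω) :
    armLik α m ρ A Z a 0 ω = 1 := by
  simp [armLik, pulls, obsSum, mixLik_zero_zero]

lemma armLik_succ_of_ne {a : Fin K} {t : ℕ} {ω : Ω} (h : A (t + 1) ω ≠ a) :
    armLik α m ρ A Z a (t + 1) ω = armLik α m ρ A Z a t ω := by
  simp [armLik, pulls_succ, obsSum_succ, h]

lemma armLik_succ_of_eq {a : Fin K} {t : ℕ} {ω : Ω} (h : A (t + 1) ω = a) :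
    armLik α m ρ A Z a (t + 1) ω
      = mixLik α (α / m a) (ρ a) (pulls A a t ω + 1) (obsSum A Z a t ω + Z (t + 1) ω) := by
  simp [armLik, pulls_succ, obsSum_succ, h]

variable [mΩ : MeasurableSpace Ω] {P : Measure Ω}

lemma IsGammaBandit.history_le (h : IsGammaBandit P α m A Z) (t : ℕ) : history A Z t ≤ mΩ :=
  (historyFiltration A Z h.measurable_arm h.measurable_obs).le t

variable [IsProbabilityMeasure P]

lemma IsGammaBandit.ae_obs_pos (h : IsGammaBandit P α m A Z) : ∀ᵐ ω ∂P, ∀ t, 0 < Z (t + 1) ω := by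
  rw [ae_all_iff]
  intro t
  have hG : history A Z t ⊔ MeasurableSpace.comap (A (t + 1)) inferInstance ≤ mΩ :=
    sup_le (h.history_le t) (h.measurable_arm _).comap_le
  have hB := (h.measurable_obs (t + 1)) (measurableSet_Iic (a := (0 : ℝ)))
  have key := integral_condExp (μ := P) hG
    (f := (Z (t + 1) ⁻¹' Set.Iic 0).indicator (fun _ => (1 : ℝ)))
  rw [integral_congr_ae (h.cond_law t _ measurableSet_Iic), integral_indicator hB] at key
  simp only [gammaLaw, measureReal_def, gammaMeasure_Iic_zero] at key
  simp only [ENNReal.toReal_zero, integral_const, smul_eq_mul, mul_zero, mul_one,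
    measureReal_restrict_apply_univ] at key
  rw [ae_iff]
  rw [eq_comm, measureReal_eq_zero_iff] at key
  convert key using 2
  ext; simp

/-- The closed form `kl_eq` requires a positive empirical mean; this supplies it outside a null set
common to all arms and times. -/
lemma IsGammaBandit.ae_obsSum_pos (h : IsGammaBandit P α m A Z) :
    ∀ᵐ ω ∂P, ∀ (a : Fin K) (t : ℕ), pulls A a t ω ≠ 0 → 0 < obsSum A Z a t ω := by
  filter_upwards [h.ae_obs_pos] with ω hω a t
  have hnn : ∀ s ∈ Finset.Icc 1 t, 0 < Z s ω := by
    intro s hs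
    obtain ⟨u, rfl⟩ : ∃ u, s = u + 1 := ⟨s - 1, by have := (Finset.mem_Icc.1 hs).1; omega⟩
    exact hω u
  intro hp
  obtain ⟨s, hs, hsA⟩ := Finset.exists_ne_zero_of_sum_ne_zero hp
  refine Finset.sum_pos' (fun u hu => ?_) ⟨s, hs, ?_⟩
  · split_ifs
    exacts [(hnn u hu).le, le_rfl]
  · rw [if_pos (by by_contra hne; simp [hne] at hsA)]
    exact hnn s hs

variable [∀ a, IsProbabilityMeasure (ρ a)]

/-- Split `F` by the arm `k` selected next. On each piece only the factor of arm `k` can change, and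
there the new observation is independent of the history with the law of arm `k`, so Fubini and
`lintegral_mixLik_succ` remove it. -/
lemma IsGammaBandit.setLIntegral_prod_armLik_succ (h : IsGammaBandit P α m A Z) (hα : 0 < α)
    (hm : ∀ a, 0 < m a) (hρ : ∀ a, ρ a (Set.Iic 0) = 0) (S : Finset (Fin K)) (t : ℕ) {F : Set Ω}
    (hF : MeasurableSet[history A Z t] F) :
    ∫⁻ ω in F, ∏ a ∈ S, armLik α m ρ A Z a (t + 1) ω ∂P
      = ∫⁻ ω in F, ∏ a ∈ S, armLik α m ρ A Z a t ω ∂P := by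
  have hH := h.history_le t
  have hAm := h.measurable_arm (t + 1)
  have hE : ∀ k, MeasurableSet (F ∩ A (t + 1) ⁻¹' {k}) := fun k =>
    (hH _ hF).inter (hAm (measurableSet_singleton k))
  have hU : F = ⋃ k, F ∩ A (t + 1) ⁻¹' {k} := by ext; simp
  have hdisj : Pairwise (Function.onFun Disjoint fun k => F ∩ A (t + 1) ⁻¹' {k}) := by
    intro i j hij
    refine Set.disjoint_left.2 fun ω h1 h2 => hij ?_
    exact h1.2.symm.trans h2.2
  rw [hU, lintegral_iUnion hE hdisj, lintegral_iUnion hE hdisj]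
  congr 1
  funext k
  by_cases hk : k ∈ S
  swap
  · refine setLIntegral_congr_fun (hE k) fun ω hω => Finset.prod_congr rfl fun a ha => ?_
    refine armLik_succ_of_ne fun hne => hk ?_
    rwa [← (show A (t + 1) ω = k from hω.2), hne]
  set r := α / m k
  have hr : 0 < r := div_pos hα (hm k)
  have : IsProbabilityMeasure (gammaMeasure α r) := isProbabilityMeasure_gammaMeasure hα hr
  have hHG : history A Z t ≤ history A Z t ⊔ MeasurableSpace.comap (A (t + 1)) inferInstance :=
    le_sup_left
  have hG : history A Z t ⊔ MeasurableSpace.comap (A (t + 1)) inferInstance ≤ mΩ := sup_le hH hAm.comap_le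
  -- All that the updated product needs from the past: the unchanged factors, and the count and sum
  -- of arm `k`.
  set Y : Ω → ℝ≥0∞ × ℕ × ℝ := fun ω =>
    (∏ a ∈ S.erase k, armLik α m ρ A Z a t ω, pulls A k t ω, obsSum A Z k t ω) with hYdef
  have hYH : Measurable[history A Z t] Y := by
    let _ := history A Z t
    exact (Finset.measurable_fun_prod _ fun a _ => measurable_armLik a t).prodMk
      ((measurable_pulls k t).prodMk (measurable_obsSum k t))
  have hY : Measurable Y := hYH.mono hH le_rfl
  have hmap := map_restrict_prod_of_condExp (P := P) hG (E := F ∩ A (t + 1) ⁻¹' {k})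
    (MeasurableSet.inter (hHG _ hF)
      ((le_sup_right : _ ≤ history A Z t ⊔ MeasurableSpace.comap (A (t + 1)) inferInstance) _ ⟨{k}, measurableSet_singleton k, rfl⟩))
    (hYH.mono hHG le_rfl) (h.measurable_obs (t + 1)) (ν := gammaMeasure α r)
    (fun B hB => (h.cond_law t B hB).mono fun ω hω hωE => by
      have hk' : A (t + 1) ω = k := hωE.2
      simp only [hω, hk', gammaLaw, r])
  set f : (ℝ≥0∞ × ℕ × ℝ) × ℝ → ℝ≥0∞ := fun q =>
    q.1.1 * mixLik α r (ρ k) (q.1.2.1 + 1) (q.1.2.2 + q.2) with hf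
  have hfm : Measurable f := by
    have h1 : Measurable fun q : (ℝ≥0∞ × ℕ × ℝ) × ℝ => q.1.1 := by fun_prop
    have h2 : Measurable fun q : (ℝ≥0∞ × ℕ × ℝ) × ℝ => q.1.2.1 + 1 := by fun_prop
    exact h1.mul (h2.mixLik (by fun_prop))
  calc ∫⁻ ω in F ∩ A (t + 1) ⁻¹' {k}, ∏ a ∈ S, armLik α m ρ A Z a (t + 1) ω ∂P
      = ∫⁻ ω in F ∩ A (t + 1) ⁻¹' {k}, f (Y ω, Z (t + 1) ω) ∂P := by
        refine setLIntegral_congr_fun (hE k) fun ω hω => ?_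
        have hωk : A (t + 1) ω = k := hω.2
        rw [← Finset.prod_erase_mul _ _ hk, armLik_succ_of_eq hωk]
        simp only [hf, hYdef]
        congr 1
        refine Finset.prod_congr rfl fun a ha => armLik_succ_of_ne fun hne => ?_
        exact (Finset.mem_erase.1 ha).1 (hne.symm.trans hωk)
    _ = ∫⁻ q, f q ∂(((P.restrict (F ∩ A (t + 1) ⁻¹' {k})).map Y).prod (gammaMeasure α r)) := by
        rw [← hmap, lintegral_map hfm (hY.prodMk (h.measurable_obs _))]
    _ = ∫⁻ y, y.1 * mixLik α r (ρ k) y.2.1 y.2.2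
          ∂((P.restrict (F ∩ A (t + 1) ⁻¹' {k})).map Y) := by
        rw [lintegral_prod _ hfm.aemeasurable]
        refine lintegral_congr fun y => ?_
        simp only [hf]
        rw [lintegral_const_mul _ ((measurable_const (a := y.2.1 + 1)).mixLik (measurable_const_add y.2.2)),
          lintegral_mixLik_succ hα hr _ (hρ k)]
    _ = ∫⁻ ω in F ∩ A (t + 1) ⁻¹' {k}, ∏ a ∈ S, armLik α m ρ A Z a t ω ∂P := by
        rw [lintegral_map _ hY]
        · refine lintegral_congr fun ω => ?_
          rw [← Finset.prod_erase_mul _ _ hk]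
          rfl
        · exact measurable_fst.mul ((measurable_mixLik α r (ρ k)).comp measurable_snd)

lemma IsGammaBandit.lintegral_prod_armLik (h : IsGammaBandit P α m A Z) (hα : 0 < α)
    (hm : ∀ a, 0 < m a) (hρ : ∀ a, ρ a (Set.Iic 0) = 0) (S : Finset (Fin K)) (t : ℕ) :
    ∫⁻ ω, ∏ a ∈ S, armLik α m ρ A Z a t ω ∂P = 1 := by
  induction t with
  | zero => simp [armLik_zero]
  | succ t ih =>
    have := h.setLIntegral_prod_armLik_succ hα hm hρ S t (F := Set.univ) MeasurableSet.univ
    rw [← ih]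
    simpa using this

lemma IsGammaBandit.ae_armLik_ne_top (h : IsGammaBandit P α m A Z) (hα : 0 < α)
    (hm : ∀ a, 0 < m a) (hρ : ∀ a, ρ a (Set.Iic 0) = 0) :
    ∀ᵐ ω ∂P, ∀ (a : Fin K) (t : ℕ), armLik α m ρ A Z a t ω ≠ ∞ := by
  rw [ae_all_iff]
  refine fun a => ae_all_iff.2 fun t => ?_
  have h1 := h.lintegral_prod_armLik hα hm hρ {a} t
  simp only [Finset.prod_singleton] at h1
  filter_upwards [ae_lt_top ((measurable_armLik a t).mono (h.history_le t) le_rfl)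
    (h1.trans_ne ENNReal.one_ne_top)] with ω hω using hω.ne

lemma IsGammaBandit.martingale_prod_armLik (h : IsGammaBandit P α m A Z) (hα : 0 < α)
    (hm : ∀ a, 0 < m a) (hρ : ∀ a, ρ a (Set.Iic 0) = 0) (S : Finset (Fin K)) :
    Martingale (fun t ω => ∏ a ∈ S, (armLik α m ρ A Z a t ω).toReal)
      (historyFiltration A Z h.measurable_arm h.measurable_obs) P := by
  have hmeas : ∀ t, Measurable[history A Z t] (fun ω => ∏ a ∈ S, armLik α m ρ A Z a t ω) := by
    intro t
    let _ := history A Z t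
    exact Finset.measurable_fun_prod _ fun a _ => measurable_armLik a t
  have hfin : ∀ t, ∫⁻ ω, ∏ a ∈ S, armLik α m ρ A Z a t ω ∂P ≠ ∞ := fun t =>
    (h.lintegral_prod_armLik hα hm hρ S t).trans_ne ENNReal.one_ne_top
  have hm' : ∀ t, Measurable (fun ω => ∏ a ∈ S, armLik α m ρ A Z a t ω) := fun t =>
    (hmeas t).mono (h.history_le t) le_rfl
  simp_rw [← ENNReal.toReal_prod]
  refine martingale_of_setIntegral_eq_succ (fun t => ?_) (fun t => ?_) fun t F hF => ?_
  · exact (hmeas t).ennreal_toReal.stronglyMeasurable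
  · exact integrable_toReal_of_lintegral_ne_top (hm' t).aemeasurable (hfin t)
  · have hlt : ∀ t, ∀ᵐ ω ∂P.restrict F, ∏ a ∈ S, armLik α m ρ A Z a t ω < ∞ := fun t =>
      ae_restrict_of_ae (ae_lt_top (hm' t) (hfin t))
    rw [integral_toReal (hm' t).aemeasurable (hlt t),
      integral_toReal (hm' (t + 1)).aemeasurable (hlt (t + 1)),
      h.setLIntegral_prod_armLik_succ hα hm hρ S t hF]

lemma IsGammaBandit.isTestMartingale_armLik (h : IsGammaBandit P α m A Z) (hα : 0 < α)
    (hm : ∀ a, 0 < m a) (hρ : ∀ a, ρ a (Set.Iic 0) = 0) (a : Fin K) :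
    IsTestMartingale P (historyFiltration A Z h.measurable_arm h.measurable_obs)
      (fun t ω => (armLik α m ρ A Z a t ω).toReal) where
  martingale := by simpa using h.martingale_prod_armLik hα hm hρ {a}
  nonneg := fun _ _ => ENNReal.toReal_nonneg
  init := fun ω => by simp [armLik_zero]

end

end

/-! ### Gamma function inequalities and the beta prime mixture. -/

lemma lintegral_rpow_mul_exp_neg_mul {a r : ℝ} (ha : 0 < a) (hr : 0 < r) :
    ∫⁻ t in Set.Ioi (0 : ℝ), ENNReal.ofReal (t ^ (a - 1) * Real.exp (-(r * t)))
      = ENNReal.ofReal ((1 / r) ^ a * Real.Gamma a) := by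
  have hpos := Real.Gamma_pos_of_pos ha
  have h := Real.integral_rpow_mul_exp_neg_mul_Ioi ha hr
  rw [← h, ofReal_integral_eq_lintegral_ofReal]
  · exact Integrable.of_integral_ne_zero (by rw [h]; positivity)
  · filter_upwards [ae_restrict_mem measurableSet_Ioi] with t ht
    have : (0 : ℝ) < t := ht
    positivity

/-- The map `x ↦ Γ(x + 1) (e / x) ^ x` is increasing. -/
lemma Gamma_add_one_mul_exp_le {x y : ℝ} (hx : 0 < x) (hxy : x ≤ y) :
    Real.exp (y * Real.log y - y - (x * Real.log x - x)) * Real.Gamma (x + 1)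
      ≤ Real.Gamma (y + 1) := by
  have hy : 0 < y := hx.trans_le hxy
  set d := y - x with hd
  have hd0 : 0 ≤ d := by linarith
  have hG : ∀ z : ℝ, 0 < z → ENNReal.ofReal (Real.Gamma (z + 1))
      = ∫⁻ t, (Set.Ioi (0 : ℝ)).indicator
        (fun t => ENNReal.ofReal (t ^ z * Real.exp (-t))) t := by
    intro z hz
    have := lintegral_rpow_mul_exp_neg_mul (a := z + 1) (by linarith) one_pos
    simp only [add_sub_cancel_right, one_mul, div_one, Real.one_rpow] at this
    rw [lintegral_indicator measurableSet_Ioi, this]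
  -- Translating the integral for `y` by `d = y - x` reduces the claim to a pointwise comparison of
  -- integrands.
  rw [← ENNReal.ofReal_le_ofReal_iff (Real.Gamma_pos_of_pos (by linarith)).le,
    ENNReal.ofReal_mul (Real.exp_pos _).le, hG x hx, hG y hy,
    ← lintegral_add_right_eq_self 
      ((Set.Ioi (0 : ℝ)).indicator fun t => ENNReal.ofReal (t ^ y * Real.exp (-t))) d,
    ← lintegral_const_mul' _ _ ENNReal.ofReal_ne_top]
  refine lintegral_mono fun t => ?_
  by_cases ht : t ∈ Set.Ioi (0 : ℝ)
  swap
  · simp [Set.indicator_of_notMem ht]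
  have ht0 : 0 < t := ht
  have htd : t + d ∈ Set.Ioi (0 : ℝ) := by simp only [Set.mem_Ioi]; linarith
  have htd0 : 0 < t + d := htd
  rw [Set.indicator_of_mem ht, Set.indicator_of_mem htd, ← ENNReal.ofReal_mul (Real.exp_pos _).le]
  refine ENNReal.ofReal_le_ofReal ?_
  rw [Real.rpow_def_of_pos ht0, Real.rpow_def_of_pos htd0, ← Real.exp_add, ← Real.exp_add,
    ← Real.exp_add]
  refine Real.exp_le_exp.2 ?_
  -- `(t + d) / y` is the average of `t / x` and `1` with weights `x / y` and `d / y`, and `log 1 =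
  -- 0`.
  have hconc := strictConcaveOn_log_Ioi.concaveOn.2 (show t / x ∈ Set.Ioi (0 : ℝ) from
    div_pos ht0 hx) (Set.mem_Ioi.2 one_pos)
    (show 0 ≤ x / y by positivity) (show 0 ≤ d / y by positivity) (by rw [hd]; field_simp; ring)
  simp only [smul_eq_mul, Real.log_one, mul_zero, add_zero, mul_one] at hconc
  rw [show x / y * (t / x) + d / y = (t + d) / y by field_simp, Real.log_div ht0.ne' hx.ne',
    Real.log_div htd0.ne' hy.ne', div_mul_eq_mul_div, div_le_iff₀ hy] at hconc
  rw [hd] at *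
  linarith

lemma Gamma_mul_exp_le {x y : ℝ} (hx : 0 < x) (hxy : x ≤ y) :
    x / y * Real.exp (y * Real.log y - y - (x * Real.log x - x)) * Real.Gamma x
      ≤ Real.Gamma y := by
  have hy : 0 < y := hx.trans_le hxy
  have h := Gamma_add_one_mul_exp_le hx hxy
  rw [Real.Gamma_add_one hx.ne', Real.Gamma_add_one hy.ne'] at h
  rw [div_mul_eq_mul_div, div_mul_eq_mul_div, div_le_iff₀ hy]
  linarith

/-- The beta prime law: the law of the quotient of two independent Gamma variables with shapes `p`
and `q`. -/
noncomputable def betaPrime (p q : ℝ) : Measure ℝ :=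
  (volume.restrict (Set.Ioi 0)).withDensity fun v =>
    ENNReal.ofReal (v ^ (p - 1) * (1 + v) ^ (-(p + q)) / beta p q)

/-- The power of `1 + v` is written as a Gamma integral in a variable `r`; integrating over `v`
first leaves a product of two Gamma integrals. -/
lemma lintegral_beta_kernel {p q : ℝ} (hp : 0 < p) (hq : 0 < q) :
    ∫⁻ v in Set.Ioi (0 : ℝ), ENNReal.ofReal (v ^ (p - 1) * (1 + v) ^ (-(p + q)))
      = ENNReal.ofReal (beta p q) := by
  have hpq := add_pos hp hq
  have hΓ := Real.Gamma_pos_of_pos hpq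
  have hΓp := Real.Gamma_pos_of_pos hp
  set F : ℝ → ℝ → ℝ≥0∞ := fun v r =>
    ENNReal.ofReal (v ^ (p - 1) * r ^ (p + q - 1) * Real.exp (-((1 + v) * r))) with hF
  have h1 : ∀ v ∈ Set.Ioi (0 : ℝ), ∫⁻ r in Set.Ioi (0 : ℝ), F v r
      = ENNReal.ofReal (Real.Gamma (p + q))
        * ENNReal.ofReal (v ^ (p - 1) * (1 + v) ^ (-(p + q))) := by
    intro v (hv : 0 < v)
    simp only [hF, mul_assoc (v ^ (p - 1))]
    simp_rw [ENNReal.ofReal_mul (show 0 ≤ v ^ (p - 1) by positivity)]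
    rw [lintegral_const_mul' _ _ ENNReal.ofReal_ne_top,
      lintegral_rpow_mul_exp_neg_mul hpq (show 0 < 1 + v by linarith),
      ← ENNReal.ofReal_mul (by positivity), ← ENNReal.ofReal_mul (by positivity),
      ← ENNReal.ofReal_mul (by positivity), one_div, Real.inv_rpow (by positivity),
      Real.rpow_neg (by positivity)]
    congr 1
    ring
  have h2 : ∀ r ∈ Set.Ioi (0 : ℝ), ∫⁻ v in Set.Ioi (0 : ℝ), F v r
      = ENNReal.ofReal (Real.Gamma p) * ENNReal.ofReal (r ^ (q - 1) * Real.exp (-(1 * r))) := by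
    intro r (hr : 0 < r)
    have hsplit : ∀ v, F v r = ENNReal.ofReal (r ^ (p + q - 1) * Real.exp (-r))
        * ENNReal.ofReal (v ^ (p - 1) * Real.exp (-(r * v))) := by
      intro v
      rw [← ENNReal.ofReal_mul (by positivity)]
      simp only [hF]
      rw [show -((1 + v) * r) = -r + -(r * v) by ring, Real.exp_add]
      congr 1
      ring
    simp_rw [hsplit]
    rw [lintegral_const_mul' _ _ ENNReal.ofReal_ne_top, lintegral_rpow_mul_exp_neg_mul hp hr,
      ← ENNReal.ofReal_mul (by positivity), ← ENNReal.ofReal_mul (by positivity), one_div,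
      Real.inv_rpow hr.le, show p + q - 1 = p + (q - 1) by ring, Real.rpow_add hr, one_mul]
    congr 1
    have := Real.rpow_pos_of_pos hr p
    field_simp
  have hswap : ∫⁻ v in Set.Ioi (0 : ℝ), ∫⁻ r in Set.Ioi (0 : ℝ), F v r
      = ∫⁻ r in Set.Ioi (0 : ℝ), ∫⁻ v in Set.Ioi (0 : ℝ), F v r :=
    lintegral_lintegral_swap (by simp only [hF, Function.uncurry_def]; fun_prop)
  rw [setLIntegral_congr_fun measurableSet_Ioi h1, setLIntegral_congr_fun measurableSet_Ioi h2,
    lintegral_const_mul' _ _ ENNReal.ofReal_ne_top, lintegral_const_mul' _ _ ENNReal.ofReal_ne_top,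
    lintegral_rpow_mul_exp_neg_mul hq one_pos, div_one, Real.one_rpow, one_mul,
    ← ENNReal.ofReal_mul hΓp.le] at hswap
  rw [beta, ENNReal.ofReal_div_of_pos hΓ, ← hswap, mul_comm, ENNReal.mul_div_cancel_right]
  · simpa using hΓ
  · exact ENNReal.ofReal_ne_top

lemma isProbabilityMeasure_betaPrime {p q : ℝ} (hp : 0 < p) (hq : 0 < q) :
    IsProbabilityMeasure (betaPrime p q) where
  measure_univ := by
    have hb := beta_pos hp hq
    rw [betaPrime, withDensity_apply _ MeasurableSet.univ, Measure.restrict_univ]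
    simp_rw [ENNReal.ofReal_div_of_pos hb, div_eq_mul_inv]
    rw [lintegral_mul_const' _ _ (by simpa using hb), lintegral_beta_kernel hp hq]
    exact ENNReal.mul_inv_cancel (by simpa using hb) ENNReal.ofReal_ne_top

/-- The mixture of the likelihood ratios over the rates `(1 - l) (1 + v)`, `v` having the beta prime
law tuned to the total shape `b`, dominates the tempered maximal likelihood ratio at every total
shape `a ≥ b`. -/
lemma le_lintegral_betaPrime {l b a s : ℝ} (hl0 : 0 < l) (hl1 : l < 1) (hb : 0 < b) (hba : b ≤ a)
    (hs : 0 < s) :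
    ENNReal.ofReal ((1 - l) * (b / a) *
        Real.exp (l * (s - a - a * Real.log (s / a))))
      ≤ ∫⁻ v, ENNReal.ofReal (((1 - l) * (1 + v)) ^ a *
          Real.exp (-(((1 - l) * (1 + v) - 1) * s))) ∂betaPrime (l * b) ((1 - l) * b) := by
  have ha : 0 < a := hb.trans_le hba
  have hl' : 0 < 1 - l := by linarith
  have hp : 0 < l * b := by positivity
  have hq : 0 < (1 - l) * b := by positivity
  have hB := beta_pos hp hq
  have hla : 0 < l * a := by positivity
  rw [betaPrime, lintegral_withDensity_eq_lintegral_mul _ (by fun_prop) (by fun_prop)]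
  -- `c` collects the factors free of `v` once `(1 + v) ^ (a - b)` is bounded below by a multiple of
  -- `v ^ (l (a - b))`; what is left is a Gamma integrand of shape `l a`.
  set c : ℝ := (1 - l) ^ a * Real.exp (l * s) / beta (l * b) ((1 - l) * b) *
    Real.exp ((a - b) * (-(1 - l) * Real.log (1 - l) - l * Real.log l)) with hc
  have hc0 : 0 < c := by positivity
  have hpt : ∀ v ∈ Set.Ioi (0 : ℝ), ENNReal.ofReal c *
      ENNReal.ofReal (v ^ (l * a - 1) * Real.exp (-((1 - l) * s * v))) ≤
      ((fun v => ENNReal.ofReal (v ^ (l * b - 1) * (1 + v) ^ (-(l * b + (1 - l) * b)) /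
        beta (l * b) ((1 - l) * b))) * fun v => ENNReal.ofReal (((1 - l) * (1 + v)) ^ a *
          Real.exp (-(((1 - l) * (1 + v) - 1) * s)))) v := by
    intro v (hv : 0 < v)
    have hv1 : 0 < 1 + v := by linarith
    rw [Pi.mul_apply, ← ENNReal.ofReal_mul hc0.le, ← ENNReal.ofReal_mul (by positivity)]
    refine ENNReal.ofReal_le_ofReal ?_
    -- `1 + v` is the average of `1 / (1 - l)` and `v / l` with weights `1 - l` and `l`, so `log (1
    -- + v)` is at least `l log v` plus the entropy of `l`.
    have hconc := strictConcaveOn_log_Ioi.concaveOn.2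
      (show 1 / (1 - l) ∈ Set.Ioi (0 : ℝ) from div_pos one_pos hl')
      (show v / l ∈ Set.Ioi (0 : ℝ) from div_pos hv hl0) hl'.le hl0.le (by ring)
    simp only [smul_eq_mul] at hconc
    rw [show (1 - l) * (1 / (1 - l)) + l * (v / l) = 1 + v by field_simp,
      Real.log_div one_ne_zero hl'.ne', Real.log_div hv.ne' hl0.ne', Real.log_one] at hconc
    rw [hc, Real.mul_rpow hl'.le hv1.le, Real.rpow_def_of_pos hv, Real.rpow_def_of_pos hv,
      Real.rpow_def_of_pos hv1, Real.rpow_def_of_pos hv1]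
    have key : Real.exp ((a - b) * (-(1 - l) * Real.log (1 - l) - l * Real.log l)) *
        Real.exp (Real.log v * (l * a - 1)) * Real.exp (l * s) * Real.exp (-((1 - l) * s * v))
        ≤ Real.exp (Real.log v * (l * b - 1)) * Real.exp (Real.log (1 + v) *
          -(l * b + (1 - l) * b)) * Real.exp (Real.log (1 + v) * a) *
          Real.exp (-(((1 - l) * (1 + v) - 1) * s)) := by
      simp only [← Real.exp_add]
      refine Real.exp_le_exp.2 ?_
      have := mul_le_mul_of_nonneg_left hconc (sub_nonneg.2 hba)
      linarith
    have := mul_le_mul_of_nonneg_left key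
      (show 0 ≤ (1 - l) ^ a / beta (l * b) ((1 - l) * b) by positivity)
    refine le_of_eq_of_le ?_ (this.trans_eq ?_) <;> ring
  refine le_trans ?_ (setLIntegral_mono' measurableSet_Ioi hpt)
  rw [lintegral_const_mul' _ _ ENNReal.ofReal_ne_top,
    lintegral_rpow_mul_exp_neg_mul hla (by positivity), ← ENNReal.ofReal_mul hc0.le]
  refine ENNReal.ofReal_le_ofReal ?_
  -- The prefactors `l b / (l a)` and `(1 - l) b / b` of these two bounds are the whole loss `(1 -
  -- l) (b / a)`; all exponentials combine exactly.
  have g1 := Gamma_mul_exp_le hp (mul_le_mul_of_nonneg_left hba hl0.le)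
  have g2 := Gamma_mul_exp_le hq (show (1 - l) * b ≤ b by nlinarith)
  have hΓp := Real.Gamma_pos_of_pos hp
  have hΓq := Real.Gamma_pos_of_pos hq
  have g := mul_le_mul g1 g2 (by positivity) (Real.Gamma_pos_of_pos hla).le
  set D : ℝ := (1 - l) ^ a * Real.exp (l * s) *
    Real.exp ((a - b) * (-(1 - l) * Real.log (1 - l) - l * Real.log l)) *
    (1 / ((1 - l) * s)) ^ (l * a) / (Real.Gamma (l * b) * Real.Gamma ((1 - l) * b)) with hD
  have hD0 : 0 < D := by positivity
  calc (1 - l) * (b / a) * Real.exp (l * (s - a - a * Real.log (s / a)))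
      = D * (l * b / (l * a) *
          Real.exp (l * a * Real.log (l * a) - l * a - (l * b * Real.log (l * b) - l * b)) *
          Real.Gamma (l * b) * ((1 - l) * b / b * Real.exp (b * Real.log b - b -
          ((1 - l) * b * Real.log ((1 - l) * b) - (1 - l) * b)) * Real.Gamma ((1 - l) * b))) := by
        rw [hD, Real.rpow_def_of_pos hl', Real.rpow_def_of_pos (by positivity), one_div,
          Real.log_inv, Real.log_mul hl'.ne' hs.ne', Real.log_mul hl0.ne' ha.ne',
          Real.log_mul hl0.ne' hb.ne', Real.log_mul hl'.ne' hb.ne', Real.log_div hs.ne' ha.ne']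
        have hexp : Real.exp (l * (s - a - a * (Real.log s - Real.log a))) =
            Real.exp (Real.log (1 - l) * a) * Real.exp (l * s) *
            Real.exp ((a - b) * (-(1 - l) * Real.log (1 - l) - l * Real.log l)) *
            Real.exp (-(Real.log (1 - l) + Real.log s) * (l * a)) *
            Real.exp (l * a * (Real.log l + Real.log a) - l * a -
              (l * b * (Real.log l + Real.log b) - l * b)) *
            Real.exp (b * Real.log b - b -
              ((1 - l) * b * (Real.log (1 - l) + Real.log b) - (1 - l) * b)) := by
          simp only [← Real.exp_add]
          congr 1
          ring
        rw [hexp]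
        field_simp
    _ ≤ D * (Real.Gamma (l * a) * Real.Gamma b) := mul_le_mul_of_nonneg_left g hD0.le
    _ = c * ((1 / ((1 - l) * s)) ^ (l * a) * Real.Gamma (l * a)) := by
        have hΓ := (Real.Gamma_pos_of_pos hb).ne'
        rw [hc, hD, beta, show l * b + (1 - l) * b = b by ring]
        field_simp

/-! ### A lower bound for the zeta function. -/

/-- A convex function lies above its tangents. This is the discrete form of comparing a sum with an
integral, and it makes both series below telescope. -/
lemma rpow_neg_tangent_le {x y p : ℝ} (hx : 0 < x) (hy : 0 < y) (hp : 0 ≤ p) :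
    x ^ (-p) - p * x ^ (-(p + 1)) * (y - x) ≤ y ^ (-p) := by
  have hlog : Real.log (y / x) ≤ y / x - 1 := Real.log_le_sub_one_of_pos (by positivity)
  have h1 : x ^ (-(p + 1)) = x ^ (-p) / x := by
    rw [neg_add, ← sub_eq_add_neg, Real.rpow_sub_one hx.ne']
  have h2 : y ^ (-p) = x ^ (-p) * Real.exp (-p * Real.log (y / x)) := by
    rw [Real.rpow_def_of_pos hx, Real.rpow_def_of_pos hy, ← Real.exp_add,
      Real.log_div hy.ne' hx.ne']
    congr 1
    ring
  have h3 : 1 - p * (y / x - 1) ≤ Real.exp (-p * Real.log (y / x)) := by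
    have := Real.add_one_le_exp (-p * Real.log (y / x))
    nlinarith
  rw [h1, h2]
  calc x ^ (-p) - p * (x ^ (-p) / x) * (y - x) = x ^ (-p) * (1 - p * (y / x - 1)) := by
        field_simp
    _ ≤ _ := mul_le_mul_of_nonneg_left h3 (by positivity)

lemma summable_one_div_succ_rpow {s : ℝ} (hs : 1 < s) :
    Summable fun n : ℕ => 1 / ((n : ℝ) + 1) ^ s := by
  have := (summable_nat_add_iff 1).2 (Real.summable_one_div_nat_rpow.2 hs)
  simpa using this

lemma riemannZeta_re_eq_tsum {s : ℝ} (hs : 1 < s) :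
    (riemannZeta (s : ℂ)).re = ∑' n : ℕ, 1 / ((n : ℝ) + 1) ^ s := by
  rw [zeta_eq_tsum_one_div_nat_add_one_cpow (by simpa using hs)]
  have : ∀ n : ℕ, 1 / ((n : ℂ) + 1) ^ (s : ℂ) = ((1 / ((n : ℝ) + 1) ^ s : ℝ) : ℂ) := by
    intro n
    rw [Complex.ofReal_div, Complex.ofReal_cpow (by positivity)]
    simp
  simp_rw [this]
  rw [← Complex.ofReal_tsum, Complex.ofReal_re]

lemma inv_sub_one_le_riemannZeta_re {s : ℝ} (hs : 1 < s) :
    (s - 1)⁻¹ ≤ (riemannZeta (s : ℂ)).re := by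
  set p := s - 1 with hp
  have hp0 : 0 < p := by linarith
  have hstep : ∀ n : ℕ, (((n : ℝ) + 1) ^ (-p) - ((n : ℝ) + 2) ^ (-p)) / p
      ≤ 1 / ((n : ℝ) + 1) ^ s := by
    intro n
    have h := rpow_neg_tangent_le (x := (n : ℝ) + 1) (y := (n : ℝ) + 2) (p := p)
      (by positivity) (by positivity) hp0.le
    rw [show p + 1 = s by linarith, Real.rpow_neg (by positivity) s] at h
    rw [div_le_iff₀ hp0, one_div]
    linarith
  have hsum : ∀ N : ℕ, (1 - ((N : ℝ) + 1) ^ (-p)) / p ≤ (riemannZeta (s : ℂ)).re := by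
    intro N
    rw [riemannZeta_re_eq_tsum hs]
    refine le_trans ?_ ((summable_one_div_succ_rpow hs).sum_le_tsum (Finset.range N)
      fun n _ => by positivity)
    refine le_trans (le_of_eq ?_) (Finset.sum_le_sum fun n _ => hstep n)
    induction N with
    | zero => simp
    | succ N ih =>
      rw [Finset.sum_range_succ, ← ih]
      push_cast
      rw [add_assoc (N : ℝ) 1 1, one_add_one_eq_two]
      ring
  have hlim : Filter.Tendsto (fun N : ℕ => (1 - ((N : ℝ) + 1) ^ (-p)) / p) Filter.atTop
      (nhds ((1 - 0) / p)) := by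
    refine (tendsto_const_nhds.sub ?_).div_const p
    exact (tendsto_rpow_neg_atTop hp0).comp
      (Filter.tendsto_atTop_add_const_right _ _ tendsto_natCast_atTop_atTop)
  have := le_of_tendsto' hlim hsum
  rwa [sub_zero, one_div] at this

/-! ### Mixture weights and their total mass. -/

/-- The guaranteed height `e^{-g(l)} / (1 - l) * (4 + ln k)^{-2l}` of the mixture after `k`
observations. -/
noncomputable def height (l : ℝ) (k : ℕ) : ℝ :=
  Real.exp (2 * l * (Real.log (4 * l) - 1)) / (riemannZeta ((2 * l : ℝ) : ℂ)).re *
    (4 + Real.log k) ^ (-(2 * l))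

section

variable {l : ℝ} (hl : l ∈ Set.Ioo (1 / 2 : ℝ) 1)
include hl

lemma inv_le_zeta : (2 * l - 1)⁻¹ ≤ (riemannZeta ((2 * l : ℝ) : ℂ)).re :=
  inv_sub_one_le_riemannZeta_re (by linarith [hl.1])

lemma one_le_zeta : 1 ≤ (riemannZeta ((2 * l : ℝ) : ℂ)).re :=
  le_trans ((one_le_inv₀ (by linarith [hl.1])).2 (by linarith [hl.2])) (inv_le_zeta hl)

lemma height_pos (k : ℕ) : 0 < height l k := by
  have := one_le_zeta hl
  have := Real.log_natCast_nonneg k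
  unfold height
  positivity

lemma height_anti {k n : ℕ} (hk : 0 < k) (hkn : k ≤ n) : height l n ≤ height l k := by
  have := one_le_zeta hl
  have h1 := Real.log_natCast_nonneg k
  have h2 : Real.log k ≤ Real.log n :=
    Real.log_le_log (by exact_mod_cast hk) (by exact_mod_cast hkn)
  unfold height
  refine mul_le_mul_of_nonneg_left ?_ (by positivity)
  exact Real.rpow_le_rpow_of_nonpos (by linarith) (by linarith) (by linarith [hl.1])

lemma exp_mul_le_one : Real.exp (2 * l * (Real.log l - 1)) * (2 * l + 3) ≤ 1 := by
  obtain ⟨h1, h2⟩ := hl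
  have hpos : 0 < 2 * l + 3 := by linarith
  rw [← Real.exp_log hpos, ← Real.exp_add, Real.exp_le_one_iff]
  have ha : Real.log l ≤ l - 1 := Real.log_le_sub_one_of_pos (by linarith)
  -- The tangent of the logarithm at `4`.
  have hb : Real.log (2 * l + 3) ≤ 2 * Real.log 2 + (2 * l - 1) / 4 := by
    have := Real.log_le_sub_one_of_pos (show 0 < (2 * l + 3) / 4 by positivity)
    rw [Real.log_div hpos.ne' (by norm_num), show (4 : ℝ) = 2 ^ 2 by norm_num,
      Real.log_pow] at this
    push_cast at this
    linarith
  have := Real.log_two_lt_d9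
  -- The remaining bound is a convex quadratic in `l`, negative at both ends of the interval.
  nlinarith [mul_nonneg (show 0 ≤ l - 1 / 2 by linarith) (show 0 ≤ 1 - l by linarith)]

/-- The function `(4 + ln x) ^ (-2l) / x` has the primitive `-(4 + ln x) ^ (-p) / p`, with `p = 2l -
1`. The first term is kept apart and the others telescope against this primitive. The resulting
factor `1 / p` is absorbed by `ζ(2l)`. -/
lemma sum_height_div_le_one (N : ℕ) :
    ∑ k ∈ Finset.range N, height l (k + 1) / ((k : ℝ) + 1) ≤ 1 := by
  set p := 2 * l - 1 with hp
  have hp0 : 0 < p := by linarith [hl.1]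
  have hl0 : 0 < l := by linarith [hl.1]
  have hζ := one_le_zeta hl
  have htel : ∀ M : ℕ, ∑ k ∈ Finset.range (M + 1),
      (4 + Real.log ((k : ℝ) + 1)) ^ (-(2 * l)) / ((k : ℝ) + 1)
      ≤ 4 ^ (-(2 * l)) + (4 ^ (-p) - (4 + Real.log ((M : ℝ) + 1)) ^ (-p)) / p := by
    intro M
    induction M with
    | zero => simp
    | succ M ih =>
      rw [Finset.sum_range_succ]
      have hx : 0 ≤ Real.log ((M : ℝ) + 1) := Real.log_nonneg (by linarith [M.cast_nonneg (α := ℝ)])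
      have hy : 0 ≤ Real.log ((M : ℝ) + 2) := Real.log_nonneg (by linarith [M.cast_nonneg (α := ℝ)])
      have h := rpow_neg_tangent_le (x := 4 + Real.log ((M : ℝ) + 2))
        (y := 4 + Real.log ((M : ℝ) + 1)) (p := p) (by linarith) (by linarith) hp0.le
      have hlog : 1 / ((M : ℝ) + 2) ≤ Real.log ((M : ℝ) + 2) - Real.log ((M : ℝ) + 1) := by
        rw [← Real.log_div (by positivity) (by positivity)]
        refine le_trans (le_of_eq ?_) (Real.one_sub_inv_le_log_of_pos (by positivity))
        field_simp
        ring
      have hpow : 0 < (4 + Real.log ((M : ℝ) + 2)) ^ (-(2 * l)) :=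
        Real.rpow_pos_of_pos (by linarith) _
      rw [show p + 1 = 2 * l by linarith] at h
      have hinc : (4 + Real.log ((M : ℝ) + 2)) ^ (-(2 * l)) / ((M : ℝ) + 2)
          ≤ ((4 + Real.log ((M : ℝ) + 1)) ^ (-p) - (4 + Real.log ((M : ℝ) + 2)) ^ (-p)) / p := by
        rw [le_div_iff₀ hp0]
        have := mul_le_mul_of_nonneg_left hlog (mul_pos hp0 hpow).le
        rw [mul_one_div] at this
        calc _ = p * (4 + Real.log ((M : ℝ) + 2)) ^ (-(2 * l)) / ((M : ℝ) + 2) := by ring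
          _ ≤ _ := this
          _ ≤ _ := by linarith
      push_cast
      rw [show (M : ℝ) + 1 + 1 = M + 2 by ring]
      rw [sub_div] at hinc ih ⊢
      linarith
  set C := Real.exp (2 * l * (Real.log (4 * l) - 1)) / (riemannZeta ((2 * l : ℝ) : ℂ)).re with hC
  have hC0 : 0 < C := by positivity
  have hsum : ∑ k ∈ Finset.range N, height l (k + 1) / ((k : ℝ) + 1)
      ≤ C * (4 ^ (-(2 * l)) + 4 ^ (-p) / p) := by
    have h1 : ∑ k ∈ Finset.range N, height l (k + 1) / ((k : ℝ) + 1)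
        = C * ∑ k ∈ Finset.range N,
          (4 + Real.log ((k : ℝ) + 1)) ^ (-(2 * l)) / ((k : ℝ) + 1) := by
      rw [Finset.mul_sum]
      refine Finset.sum_congr rfl fun k _ => ?_
      rw [height, ← hC, mul_div_assoc]
      push_cast
      rfl
    rw [h1]
    refine mul_le_mul_of_nonneg_left ?_ hC0.le
    have hnn : ∀ k : ℕ, 0 < 4 + Real.log ((k : ℝ) + 1) := fun k => by
      linarith [Real.log_nonneg (show (1 : ℝ) ≤ (k : ℝ) + 1 by linarith [k.cast_nonneg (α := ℝ)])]
    refine le_trans (Finset.sum_le_sum_of_subset_of_nonneg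
      (Finset.range_mono (Nat.le_succ N)) fun k _ _ => ?_) ((htel N).trans ?_)
    · have := Real.rpow_pos_of_pos (hnn k) (-(2 * l))
      positivity
    · have := Real.rpow_pos_of_pos (hnn N) (-p)
      gcongr
      linarith
  refine hsum.trans (le_trans (le_of_eq ?_)
    ((mul_le_of_le_one_right (by positivity) ?_ :
      Real.exp (2 * l * (Real.log l - 1)) * (2 * l + 3) *
        (p⁻¹ / (riemannZeta ((2 * l : ℝ) : ℂ)).re) ≤ _).trans (exp_mul_le_one hl)))
  · have h4 : (4 : ℝ) ^ (-p) = 4 ^ (-(2 * l)) * 4 := by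
      rw [hp, show -(2 * l - 1) = -(2 * l) + 1 by ring, Real.rpow_add_one (by norm_num)]
    have h5 : Real.exp (2 * l * (Real.log (4 * l) - 1)) * 4 ^ (-(2 * l))
        = Real.exp (2 * l * (Real.log l - 1)) := by
      rw [Real.log_mul (by norm_num) hl0.ne', Real.rpow_def_of_pos (by norm_num), ← Real.exp_add]
      congr 1
      ring
    rw [h4, hC, ← h5, show 2 * l + 3 = p + 4 by rw [hp]; ring]
    field_simp
  · rw [div_le_one (by positivity)]
    exact inv_le_zeta hl

end

/-! ### The prior on the relative rate. -/

/-- The law of the relative rate `(1 - l) (1 + v)`, with `v` beta prime, tuned to `k`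
observations of shape `α`. -/
noncomputable def priorComponent (α l : ℝ) (k : ℕ) : Measure ℝ :=
  (betaPrime (l * (α * k)) ((1 - l) * (α * k))).map fun v => (1 - l) * (1 + v)

/-- The mixture of the laws `priorComponent α l k` with weights `height l k / k`, completed by a
point mass at `1`. -/
noncomputable def prior (α l : ℝ) : Measure ℝ :=
  Measure.sum (fun k : ℕ =>
    ENNReal.ofReal (height l (k + 1) / ((k : ℝ) + 1)) • priorComponent α l (k + 1)) +
  (1 - ∑' k : ℕ, ENNReal.ofReal (height l (k + 1) / ((k : ℝ) + 1))) • Measure.dirac 1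

lemma prior_Iic_zero {α l : ℝ} (hl : l ∈ Set.Ioo (1 / 2 : ℝ) 1) : prior α l (Set.Iic 0) = 0 := by
  have hl' : 0 < 1 - l := by linarith [hl.2]
  have hc : ∀ k : ℕ, priorComponent α l k (Set.Iic 0) = 0 := by
    intro k
    rw [priorComponent, Measure.map_apply (by fun_prop) measurableSet_Iic]
    refine measure_mono_null (t := Set.Iic 0) (fun v hv => ?_) ?_
    · have hv' : (1 - l) * (1 + v) ≤ 0 := hv
      by_contra h
      rw [Set.mem_Iic, not_le] at h
      nlinarith [mul_pos hl' (show 0 < 1 + v by linarith)]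
    · refine withDensity_absolutelyContinuous _ _ ?_
      rw [Measure.restrict_apply measurableSet_Iic, Set.Iic_inter_Ioi, Set.Ioc_self, measure_empty]
  simp [prior, Measure.sum_apply, hc]

section

variable {α l : ℝ} (hα : 0 < α) (hl : l ∈ Set.Ioo (1 / 2 : ℝ) 1)
include hα hl

lemma isProbabilityMeasure_priorComponent (k : ℕ) :
    IsProbabilityMeasure (priorComponent α l (k + 1)) := by
  have := isProbabilityMeasure_betaPrime (p := l * (α * (k + 1 : ℕ)))
    (q := (1 - l) * (α * (k + 1 : ℕ)))
    (mul_pos (by linarith [hl.1]) (by positivity)) (mul_pos (by linarith [hl.2]) (by positivity))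
  exact Measure.isProbabilityMeasure_map (by fun_prop)

lemma isProbabilityMeasure_prior : IsProbabilityMeasure (prior α l) where
  measure_univ := by
    have := fun k => isProbabilityMeasure_priorComponent hα hl k
    have hle : ∑' k : ℕ, ENNReal.ofReal (height l (k + 1) / ((k : ℝ) + 1)) ≤ 1 := by
      refine ENNReal.tsum_le_of_sum_range_le fun N => ?_
      rw [← ENNReal.ofReal_sum_of_nonneg fun k _ => by have := height_pos hl (k + 1); positivity]
      exact ENNReal.ofReal_le_one.2 (sum_height_div_le_one hl N)
    simp only [prior, Measure.add_apply, Measure.sum_apply _ MeasurableSet.univ,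
      Measure.smul_apply, measure_univ, smul_eq_mul, mul_one]
    exact add_tsub_cancel_of_le hle

lemma le_mixLik_prior {r s : ℝ} (hr : 0 < r) (hs : 0 < s) {n : ℕ} (hn : n ≠ 0) :
    ENNReal.ofReal ((1 - l) * height l n *
        Real.exp (l * (r * s - α * n - α * n * Real.log (r * s / (α * n)))))
      ≤ mixLik α r (prior α l) n s := by
  have hn0 : (0 : ℝ) < n := by positivity
  have hl' : 0 < 1 - l := by linarith [hl.2]
  have hl0 : 0 < l := by linarith [hl.1]
  set E := Real.exp (l * (r * s - α * n - α * n * Real.log (r * s / (α * n)))) with hE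
  have hcomp : ∀ k ∈ Finset.range n,
      ENNReal.ofReal ((1 - l) * (((k : ℝ) + 1) / n) * E)
        ≤ ∫⁻ θ, ENNReal.ofReal (θ ^ (α * n) * Real.exp (-((θ - 1) * (r * s))))
          ∂priorComponent α l (k + 1) := by
    intro k hk
    have hkn : ((k : ℝ) + 1) ≤ n := by exact_mod_cast Finset.mem_range.1 hk
    rw [priorComponent, lintegral_map (by fun_prop) (by fun_prop)]
    have h := le_lintegral_betaPrime (b := α * (k + 1 : ℕ)) (a := α * n) hl0 hl.2
      (by positivity) (mul_le_mul_of_nonneg_left (by exact_mod_cast hkn) hα.le) (mul_pos hr hs)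
    refine le_trans (le_of_eq ?_) h
    rw [hE]
    push_cast
    rw [mul_div_mul_left _ _ hα.ne']
  calc ENNReal.ofReal ((1 - l) * height l n * E)
      ≤ ENNReal.ofReal (∑ k ∈ Finset.range n,
          height l (k + 1) / ((k : ℝ) + 1) * ((1 - l) * (((k : ℝ) + 1) / n) * E)) := by
        refine ENNReal.ofReal_le_ofReal ?_
        -- The weight `1 / k` cancels the factor `k / n` of component `k`, so each of the `n`
        -- components with `k ≤ n` contributes at least an equal share.
        have h1 : ∑ k ∈ Finset.range n, (1 - l) * height l n * E / n
            = (1 - l) * height l n * E := by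
          rw [Finset.sum_const, Finset.card_range, nsmul_eq_mul]
          field_simp
        rw [← h1]
        refine Finset.sum_le_sum fun k hk => ?_
        have h2 := height_anti hl (Nat.succ_pos k) (Finset.mem_range.1 hk)
        have hk0 : (0 : ℝ) < (k : ℝ) + 1 := by positivity
        calc (1 - l) * height l n * E / n = height l n * ((1 - l) * E / n) := by ring
          _ ≤ height l (k + 1) * ((1 - l) * E / n) :=
            mul_le_mul_of_nonneg_right h2 (by positivity)
          _ = _ := by field_simp
    _ = ∑ k ∈ Finset.range n, ENNReal.ofReal (height l (k + 1) / ((k : ℝ) + 1)) *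
          ENNReal.ofReal ((1 - l) * (((k : ℝ) + 1) / n) * E) := by
        have hw : ∀ k : ℕ, 0 ≤ height l (k + 1) / ((k : ℝ) + 1) := fun k => by
          have := height_pos hl (k + 1); positivity
        rw [ENNReal.ofReal_sum_of_nonneg fun k _ => mul_nonneg (hw k) (by positivity)]
        exact Finset.sum_congr rfl fun k _ => ENNReal.ofReal_mul (hw k)
    _ ≤ ∑ k ∈ Finset.range n, ENNReal.ofReal (height l (k + 1) / ((k : ℝ) + 1)) *
          ∫⁻ θ, ENNReal.ofReal (θ ^ (α * n) * Real.exp (-((θ - 1) * (r * s))))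
            ∂priorComponent α l (k + 1) :=
        Finset.sum_le_sum fun k hk => by gcongr; exact hcomp k hk
    _ ≤ mixLik α r (prior α l) n s := by
        rw [mixLik, prior, lintegral_add_measure, lintegral_sum_measure]
        refine le_trans (ENNReal.sum_le_tsum _) ?_
        simp_rw [lintegral_smul_measure, smul_eq_mul]
        exact le_self_add

end

/-! ### The function `gGamma` and the minimum defining the threshold. -/

lemma exp_neg_gGamma {l : ℝ} (hl : l ∈ Set.Ioo (1 / 2 : ℝ) 1) {n : ℕ} :
    Real.exp (-(2 * l * Real.log (4 + Real.log n)) - gGamma l) = (1 - l) * height l n := by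
  have hζ := one_le_zeta hl
  have hlog := Real.log_natCast_nonneg n
  have hl' : 0 < 1 - l := by linarith [hl.2]
  rw [height, gGamma, Real.rpow_def_of_pos (by linarith)]
  rw [show -(2 * l * Real.log (4 + Real.log n)) - (2 * l - 2 * l * Real.log (4 * l) +
      Real.log (riemannZeta ((2 * l : ℝ) : ℂ)).re - Real.log (1 - l))
    = Real.log (1 - l) + (2 * l * (Real.log (4 * l) - 1) -
      Real.log (riemannZeta ((2 * l : ℝ) : ℂ)).re +
      Real.log (4 + Real.log n) * -(2 * l)) by ring, Real.exp_add, Real.exp_log hl', Real.exp_add,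
    Real.exp_sub, Real.exp_log (by linarith)]

/-- Blow-up at both ends: `-ln (1 - l)` drives it at `1`, and `ln ζ(2l) ≥ -ln (2l - 1)` at `1/2`. -/
lemma neg_one_sub_log_le_gGamma {l : ℝ} (hl : l ∈ Set.Ioo (1 / 2 : ℝ) 1) :
    -1 - Real.log (1 - l) ≤ gGamma l ∧ -1 - Real.log (2 * l - 1) ≤ gGamma l := by
  obtain ⟨h1, h2⟩ := id hl
  have hζ := Real.log_nonneg (one_le_zeta hl)
  have hζ' := Real.log_le_log (inv_pos.2 (by linarith)) (inv_le_zeta hl)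
  rw [Real.log_inv] at hζ'
  have hlog : Real.log (1 - l) ≤ 0 := Real.log_nonpos (by linarith) (by linarith)
  have h4 : Real.log (4 * l) ≤ 2 * Real.log 2 := by
    have := Real.log_le_log (by linarith) (show 4 * l ≤ (2 : ℝ) ^ 2 by linarith)
    rw [Real.log_pow] at this
    exact_mod_cast this
  have := Real.log_two_lt_d9
  have hc : -1 ≤ 2 * l - 2 * l * Real.log (4 * l) := by nlinarith
  unfold gGamma
  constructor <;> linarith

lemma continuousOn_gGamma : ContinuousOn gGamma (Set.Ioo (1 / 2) 1) := by
  intro l hl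
  refine ContinuousAt.continuousWithinAt ?_
  have hζ := one_le_zeta hl
  have h1 : l ≠ 0 := by linarith [hl.1]
  have h2 : 1 - l ≠ 0 := by linarith [hl.2]
  have hz : ContinuousAt (fun l : ℝ => (riemannZeta ((2 * l : ℝ) : ℂ)).re) l := by
    have hne : ((2 * l : ℝ) : ℂ) ≠ 1 := by
      norm_cast
      linarith [hl.1]
    have hf : ContinuousAt (fun l : ℝ => ((2 * l : ℝ) : ℂ)) l := by fun_prop
    exact Complex.continuous_re.continuousAt.comp
      (ContinuousAt.comp (f := fun l : ℝ => ((2 * l : ℝ) : ℂ)) (g := riemannZeta)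
        (differentiableAt_riemannZeta hne).continuousAt hf)
  have hz' := hz.log (by linarith : (riemannZeta ((2 * l : ℝ) : ℂ)).re ≠ 0)
  have h3 : ContinuousAt (fun l : ℝ => 2 * l - 2 * l * Real.log (4 * l)) l :=
    ContinuousAt.sub (by fun_prop) (ContinuousAt.mul (by fun_prop)
      (ContinuousAt.log (by fun_prop) (by positivity)))
  exact (h3.add hz').sub (ContinuousAt.log (by fun_prop) h2)

lemma isLeast_threshold {x : ℝ} (hx : 0 < x) :
    IsLeast (thresholdValues (Set.Ioo (1 / 2) 1) gGamma x)
      (threshold (Set.Ioo (1 / 2) 1) gGamma x) := by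
  set f : ℝ → ℝ := fun l => (gGamma l + x) / l with hf
  set V := |f (3 / 4)| with hV
  -- Small enough that `gGamma` exceeds `V` within `ε` of either end (in the variables `2l - 1` and
  -- `1 - l`), and that `3 / 4` stays in the compact interval.
  set ε := Real.exp (-2 - V) with hε
  have hV0 : 0 ≤ V := abs_nonneg _
  have hε0 : 0 < ε := Real.exp_pos _
  have hε1 : ε ≤ 1 / 4 := by
    have h1 : ε ≤ Real.exp (-2) := Real.exp_le_exp.2 (by linarith)
    have h2 : (2 : ℝ) ≤ Real.exp 1 := by linarith [Real.add_one_le_exp (1 : ℝ)]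
    have h3 : Real.exp (-2) = (Real.exp 1 * Real.exp 1)⁻¹ := by
      rw [← Real.exp_add, ← Real.exp_neg]; norm_num
    have h4 : (Real.exp 1 * Real.exp 1)⁻¹ ≤ (4 : ℝ)⁻¹ := inv_anti₀ (by norm_num) (by nlinarith)
    linarith
  have hsub : Set.Icc ((1 + ε) / 2) (1 - ε) ⊆ Set.Ioo (1 / 2 : ℝ) 1 := fun l hl =>
    ⟨by linarith [hl.1], by linarith [hl.2]⟩
  have hmem : (3 / 4 : ℝ) ∈ Set.Icc ((1 + ε) / 2) (1 - ε) := ⟨by linarith, by linarith⟩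
  have hcont : ContinuousOn f (Set.Ioo (1 / 2) 1) :=
    (continuousOn_gGamma.add continuousOn_const).div continuousOn_id
      fun l hl => (by linarith [hl.1] : (0 : ℝ) < l).ne'
  obtain ⟨l₀, hl₀, hmin⟩ := isCompact_Icc.exists_isMinOn ⟨_, hmem⟩ (hcont.mono hsub)
  have hleast : IsLeast (thresholdValues (Set.Ioo (1 / 2) 1) gGamma x) (f l₀) := by
    refine ⟨⟨l₀, hsub hl₀, rfl⟩, ?_⟩
    rintro _ ⟨l, hl, rfl⟩
    by_cases hlI : l ∈ Set.Icc ((1 + ε) / 2) (1 - ε)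
    · exact hmin hlI
    have hfar : V ≤ gGamma l + x := by
      obtain ⟨hg1, hg2⟩ := neg_one_sub_log_le_gGamma hl
      have hlogε : Real.log ε = -2 - V := Real.log_exp _
      rw [Set.mem_Icc, not_and_or, not_le, not_le] at hlI
      rcases hlI with h | h
      · have := Real.log_le_log (by linarith [hl.1]) (show 2 * l - 1 ≤ ε by linarith)
        linarith
      · have := Real.log_le_log (by linarith [hl.2]) (show 1 - l ≤ ε by linarith)
        linarith
    have hl0 : 0 < l := by linarith [hl.1]
    calc f l₀ ≤ f (3 / 4) := hmin hmem
      _ ≤ V := le_abs_self _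
      _ ≤ gGamma l + x := hfar
      _ ≤ (gGamma l + x) / l := by
        rw [le_div_iff₀ hl0]
        exact mul_le_of_le_one_right (hV0.trans hfar) hl.2.le
  have : threshold (Set.Ioo (1 / 2) 1) gGamma x = f l₀ := hleast.csInf_eq
  rwa [this]

/-! ### Ville's inequality, the DCC property and the deviation bound. -/

section
/-- Ville's inequality for test martingales. -/
lemma measure_exists_le_of_martingale {Ω : Type*} {mΩ : MeasurableSpace Ω} {P : Measure Ω}
    [IsProbabilityMeasure P] {ℱ : Filtration ℕ mΩ} {W : ℕ → Ω → ℝ} (hW : Martingale W ℱ P)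
    (hnn : 0 ≤ W) (h0 : ∀ ω, W 0 ω = 1) (x : ℝ) :
    P {ω | ∃ t, Real.exp x ≤ W t ω} ≤ ENNReal.ofReal (Real.exp (-x)) := by
  set c : NNReal := ⟨Real.exp x, (Real.exp_pos x).le⟩ with hc
  set B : ℕ → Set Ω := fun n => {ω | (c : ℝ) ≤ (Finset.range (n + 1)).sup'
    Finset.nonempty_range_add_one fun k => W k ω} with hB
  have hcENN : (c : ℝ≥0∞) = ENNReal.ofReal (Real.exp x) :=
    (ENNReal.ofReal_eq_coe_nnreal (Real.exp_pos x).le).symm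
  have hBmem : ∀ n ω, ω ∈ B n ↔ ∃ k ∈ Finset.range (n + 1), Real.exp x ≤ W k ω := fun n ω =>
    Finset.le_sup'_iff (f := fun k => W k ω) _
  have hsub : {ω | ∃ t, Real.exp x ≤ W t ω} ⊆ ⋃ n, B n := by
    rintro ω ⟨t, ht⟩
    refine Set.mem_iUnion.2 ⟨t, ?_⟩
    exact (hBmem t ω).2 ⟨t, Finset.self_mem_range_succ t, ht⟩
  have hmono : Monotone B := by
    intro i j hij ω hω
    obtain ⟨k, hk, hkω⟩ := (hBmem i ω).1 hω
    refine (hBmem j ω).2 ⟨k, ?_, hkω⟩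
    rw [Finset.mem_range] at hk ⊢
    omega
  have hint : ∀ n, ∫ ω, W n ω ∂P = 1 := by
    intro n
    have := hW.setIntegral_eq (Nat.zero_le n) (s := Set.univ) MeasurableSet.univ
    simp only [setIntegral_univ] at this
    rw [← this]
    simp [h0]
  have hBn : ∀ n, P (B n) ≤ ENNReal.ofReal (Real.exp (-x)) := by
    intro n
    have h1 := maximal_ineq hW.submartingale hnn (ε := c) n
    have h2 : (c : ℝ≥0∞) * P (B n) ≤ 1 := by
      refine h1.trans ?_
      rw [← ENNReal.ofReal_one, ← hint n]
      exact ENNReal.ofReal_le_ofReal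
        (setIntegral_le_integral (hW.integrable n) (ae_of_all _ (hnn n)))
    rw [Real.exp_neg, ENNReal.ofReal_inv_of_pos (Real.exp_pos x), ← hcENN,
      ENNReal.le_inv_iff_mul_le, mul_comm]
    exact h2
  calc P {ω | ∃ t, Real.exp x ≤ W t ω} ≤ P (⋃ n, B n) := measure_mono hsub
    _ = ⨆ n, P (B n) := hmono.measure_iUnion
    _ ≤ _ := iSup_le hBn

variable {Ω : Type*} {K : ℕ} {A : ℕ → Ω → Fin K} {Z : ℕ → Ω → ℝ} {α : ℝ} {m : Fin K → ℝ}

lemma correction_of_ne_zero {a : Fin K} {t : ℕ} {ω : Ω} (h : pulls A a t ω ≠ 0) :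
    correction A a t ω = ((2 * Real.log (4 + Real.log (pulls A a t ω)) : ℝ) : EReal) := by
  simp [correction, h]

lemma correction_ne_bot (a : Fin K) (t : ℕ) (ω : Ω) : correction A a t ω ≠ ⊥ := by
  unfold correction
  split_ifs
  exacts [top_ne_bot, EReal.coe_ne_bot _]

lemma exp_correctedProcess_of_eq_zero {l g : ℝ} (hl : 0 < l) {a : Fin K} {t : ℕ} {ω : Ω}
    (h : pulls A a t ω = 0) :
    EReal.exp ((l : EReal) * correctedProcess α m A Z a t ω - (g : EReal)) = 0 := by
  rw [correctedProcess, correction, if_pos h, EReal.sub_top, EReal.coe_mul_bot_of_pos hl,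
    EReal.bot_sub, EReal.exp_bot]

lemma exp_correctedProcess_of_ne_zero {l g : ℝ} {a : Fin K} {t : ℕ} {ω : Ω}
    (h : pulls A a t ω ≠ 0) :
    EReal.exp ((l : EReal) * correctedProcess α m A Z a t ω - (g : EReal))
      = ENNReal.ofReal (Real.exp (l * (info α (m a) A Z a t ω
        - 2 * Real.log (4 + Real.log (pulls A a t ω))) - g)) := by
  rw [correctedProcess, correction_of_ne_zero h, ← EReal.coe_sub, ← EReal.coe_mul,
    ← EReal.coe_sub, EReal.exp_coe]

/-- An inequality between the total information and the total correction can only hold if every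
arm has been selected. -/
lemma le_sum_info_of_ge {S : Finset (Fin K)} {t : ℕ} {ω : Ω} {c : ℝ}
    (h : ∑ a ∈ S, (info α (m a) A Z a t ω : EReal) ≥ ∑ a ∈ S, correction A a t ω + (c : EReal)) :
    (∀ a ∈ S, pulls A a t ω ≠ 0) ∧
      ∑ a ∈ S, 2 * Real.log (4 + Real.log (pulls A a t ω)) + c
        ≤ ∑ a ∈ S, info α (m a) A Z a t ω := by
  have hcoe : ∀ f : Fin K → ℝ, ∑ a ∈ S, (f a : EReal) = ((∑ a ∈ S, f a : ℝ) : EReal) :=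
    fun f => (map_sum (⟨⟨((↑) : ℝ → EReal), EReal.coe_zero⟩, EReal.coe_add⟩ : ℝ →+ EReal) f S).symm
  rw [hcoe] at h
  have hne : ∀ a ∈ S, pulls A a t ω ≠ 0 := by
    intro a ha h0
    have hbot : ∀ T : Finset (Fin K), ∑ b ∈ T, correction A b t ω ≠ ⊥ := by
      intro T
      induction T using Finset.induction_on with
      | empty => simp
      | insert b T hb ih =>
        rw [Finset.sum_insert hb, Ne, EReal.add_eq_bot_iff, not_or]
        exact ⟨correction_ne_bot b t ω, ih⟩
    have htop : correction A a t ω = ⊤ := if_pos h0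
    rw [← Finset.add_sum_erase S (fun b => correction A b t ω) ha, htop, EReal.top_add_of_ne_bot (hbot _),
      EReal.top_add_coe] at h
    exact EReal.coe_ne_top _ (top_le_iff.1 h)
  refine ⟨hne, ?_⟩
  rw [Finset.sum_congr rfl fun a ha => correction_of_ne_zero (hne a ha), hcoe,
    ← EReal.coe_add] at h
  exact EReal.coe_le_coe_iff.1 h

variable [mΩ : MeasurableSpace Ω] {P : Measure Ω} [IsProbabilityMeasure P]

lemma IsGammaBandit.isDCC (h : IsGammaBandit P α m A Z) (hα : 0 < α) (hm : ∀ a, 0 < m a) :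
    IsDCC P (historyFiltration A Z h.measurable_arm h.measurable_obs) (Set.Ioo (1 / 2) 1) gGamma
      (correctedProcess α m A Z) := by
  intro l hl
  obtain ⟨ρ, hρeq⟩ : ∃ ρ : Fin K → Measure ℝ, ∀ a, ρ a = prior α l := ⟨_, fun _ => rfl⟩
  have : ∀ a, IsProbabilityMeasure (ρ a) := fun a => by
    rw [hρeq]
    exact isProbabilityMeasure_prior hα hl
  have hρ : ∀ a, ρ a (Set.Iic 0) = 0 := fun a => by rw [hρeq, prior_Iic_zero hl]
  refine ⟨fun a t ω => (armLik α m ρ A Z a t ω).toReal,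
    fun a => ⟨h.isTestMartingale_armLik hα hm hρ a, ?_⟩, h.martingale_prod_armLik hα hm hρ⟩
  filter_upwards [h.ae_obsSum_pos, h.ae_armLik_ne_top hα hm hρ] with ω hpos hfin t
  rw [ENNReal.ofReal_toReal (hfin a t)]
  by_cases hp : pulls A a t ω = 0
  · rw [exp_correctedProcess_of_eq_zero (by linarith [hl.1]) hp]
    exact bot_le
  rw [exp_correctedProcess_of_ne_zero hp]
  have hs := hpos a t hp
  have hma := hm a
  have hn : (0 : ℝ) < pulls A a t ω := by positivity
  rw [armLik, hρeq]
  refine le_trans (le_of_eq ?_) (le_mixLik_prior hα hl (div_pos hα hma) hs hp)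
  rw [← exp_neg_gGamma hl, ← Real.exp_add, info, empMean, kl_eq hα (div_pos hs hn) hma,
    show α / m a * obsSum A Z a t ω / (α * pulls A a t ω)
      = obsSum A Z a t ω / pulls A a t ω / m a by field_simp]
  congr 2
  field_simp
  ring

/-- At the minimiser `l` for `x / |S|`, the threshold is calibrated so that `l |S| C - |S| g(l) =
x`. On the event the lower bounds on the martingales then multiply to at least `exp x`. -/
lemma IsDCC.measure_exists_ge_le {ℱ : Filtration ℕ mΩ} {Λ : Set ℝ} {g : ℝ → ℝ}
    (h : IsDCC P ℱ Λ g (correctedProcess α m A Z)) (hΛ : ∀ l ∈ Λ, 0 < l) {S : Finset (Fin K)}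
    (hS : S.Nonempty) {x : ℝ}
    (hx : IsLeast (thresholdValues Λ g (x / S.card)) (threshold Λ g (x / S.card))) :
    P {ω | ∃ t : ℕ, ∑ a ∈ S, (info α (m a) A Z a t ω : EReal) ≥
        ∑ a ∈ S, correction A a t ω + (((S.card : ℝ) * threshold Λ g (x / S.card) : ℝ) : EReal)}
      ≤ ENNReal.ofReal (Real.exp (-x)) := by
  obtain ⟨l, hl, hlC⟩ := hx.1
  obtain ⟨M, hM, hprod⟩ := h l hl
  have hl0 := hΛ l hl
  have hcard : (0 : ℝ) < S.card := by exact_mod_cast hS.card_pos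
  have hC : l * ((S.card : ℝ) * threshold Λ g (x / S.card)) - S.card * g l = x := by
    rw [← hlC]
    field_simp
    ring
  refine le_trans (measure_mono_ae ?_) (measure_exists_le_of_martingale (hprod S)
    (fun t ω => Finset.prod_nonneg fun a _ => (hM a).1.nonneg t ω)
    (fun ω => Finset.prod_eq_one fun a _ => (hM a).1.init ω) x)
  filter_upwards [ae_all_iff.2 fun a => (hM a).2] with ω hω hmem
  obtain ⟨t, ht⟩ := hmem
  obtain ⟨hne, hle⟩ := le_sum_info_of_ge ht
  refine ⟨t, ?_⟩
  calc Real.exp x ≤ Real.exp (∑ a ∈ S, (l * (info α (m a) A Z a t ω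
        - 2 * Real.log (4 + Real.log (pulls A a t ω))) - g l)) := by
        refine Real.exp_le_exp.2 ?_
        rw [Finset.sum_sub_distrib, ← Finset.mul_sum, Finset.sum_sub_distrib, Finset.sum_const,
          nsmul_eq_mul]
        have := mul_le_mul_of_nonneg_left hle hl0.le
        linarith
    _ = ∏ a ∈ S, Real.exp (l * (info α (m a) A Z a t ω
        - 2 * Real.log (4 + Real.log (pulls A a t ω))) - g l) := Real.exp_sum _ _
    _ ≤ ∏ a ∈ S, M a t ω := by
        refine Finset.prod_le_prod (fun a _ => (Real.exp_pos _).le) fun a ha => ?_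
        have := hω a t
        rw [exp_correctedProcess_of_ne_zero (hne a ha)] at this
        exact (ENNReal.ofReal_le_ofReal_iff ((hM a).1.nonneg t ω)).1 this

end

end GammaBandit

theorem corollary3p3 {Ω : Type*} [MeasurableSpace Ω] (P : MeasureTheory.Measure Ω)
    [MeasureTheory.IsProbabilityMeasure P] {K : ℕ} (α : ℝ) (hα : 0 < α)
    (m : Fin K → ℝ) (hm : ∀ a, 0 < m a) (A : ℕ → Ω → Fin K) (Z : ℕ → Ω → ℝ)
    (h : GammaBandit.IsGammaBandit P α m A Z) :
    GammaBandit.IsDCC P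
        (GammaBandit.historyFiltration A Z h.measurable_arm h.measurable_obs)
        (Set.Ioo (1 / 2) 1) GammaBandit.gGamma (GammaBandit.correctedProcess α m A Z) ∧
      (∀ x : ℝ, 0 < x →
        IsLeast (GammaBandit.thresholdValues (Set.Ioo (1 / 2) 1) GammaBandit.gGamma x)
          (GammaBandit.threshold (Set.Ioo (1 / 2) 1) GammaBandit.gGamma x)) ∧
      ∀ S : Finset (Fin K), S.Nonempty → ∀ x : ℝ, 0 < x →
        P {ω | ∃ t : ℕ,
            ∑ a ∈ S, (GammaBandit.info α (m a) A Z a t ω : EReal) ≥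
              ∑ a ∈ S, GammaBandit.correction A a t ω +
                (((S.card : ℝ) * GammaBandit.threshold (Set.Ioo (1 / 2) 1) GammaBandit.gGamma
                  (x / S.card) : ℝ) : EReal)}
          ≤ ENNReal.ofReal (Real.exp (-x)) := by
  have hDCC := h.isDCC hα hm
  refine ⟨hDCC, fun x hx => GammaBandit.isLeast_threshold hx, fun S hS x hx => ?_⟩
  exact hDCC.measure_exists_ge_le (fun l hl => by linarith [hl.1]) hS
    (GammaBandit.isLeast_threshold (div_pos hx (by exact_mod_cast hS.card_pos)))
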